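/- Let $(M,g_0)$ be a compact smooth Riemannian manifold without boundary, of dimension $n\ge 3$, whose scalar curvature $S_0$ vanishes identically, and let $u_0\in C^\infty(M)$ be positive. Let $\tilde S_0$ be the scalar curvature of $u_0^{4/(n-2)}g_0$ and $\tilde S_{0,\min}=\min_M \tilde S_0$. Then there is a constant $c>0$, depending only on $(M,g_0)$ and $u_0$, such that the following holds for every strictly decreasing $f\in C^2(\mathbb R)$ and every $T\in(0,\infty]$. Let $u\colon[0,T)\times M\to(0,\infty)$ be a solution of the generalized Yamabe flow with $u(0)=u_0$, i.e. the metrics $g(t)=u(t)^{4/(n-2)}g_0$ satisfy $$\partial_t g=(f(S)-A)\,g\ \text{ on } [0,T),\qquad g(0)=u_0^{4/(n-2)}g_0,\qquad A(t)=\frac1{\mathrm{Vol}_{g(t)}(M)}\int_M f(S)\,d\mathrm{Vol}_{g(t)},$$ where $S=S(t,\cdot)$ is the scalar curvature of $g(t)$; here $u(t)\in C^2(M)$ for each $t$, and $u$ and $\Delta_0u$ ($\Delta_0$ the Laplace–Beltrami operator of $g_0$) are continuous on $[0,T)\times M$. Then, for all $t\in[0,T)$ and $p\in M$, $$0\ \ge\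 S_{\min}(t):=\min_{M}S(t,\cdot)\ \ge\ \tilde S_{0,\min},\qquad\qquad c^{-1}\le u(t,p)\le c .$$ In particular $c$ does not depend on $T$. -/

import Mathlib

open scoped Manifold ContDiff
open MeasureTheory

noncomputable section

namespace YamabeFlow

section Coordinates

/-! ### Riemannian geometry of a matrix-valued function on (an open subset of) `ℝⁿ` -/

variable {n : ℕ}

/-- The partial derivative `∂ᵢF` of a function on `ℝⁿ`. -/
def pderiv (i : Fin n) (F : EuclideanSpace ℝ (Fin n) → ℝ) (y : EuclideanSpace ℝ (Fin n)) : ℝ :=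
  fderiv ℝ F y (EuclideanSpace.single i 1)

/-- The Christoffel symbol
`Γᵏᵢⱼ = ½ ∑ₗ Gᵏˡ (∂ᵢGⱼₗ + ∂ⱼGᵢₗ - ∂ₗGᵢⱼ)` of the metric with matrix `G`. -/
def christoffel (G : EuclideanSpace ℝ (Fin n) → Matrix (Fin n) (Fin n) ℝ) (k i j : Fin n)
    (y : EuclideanSpace ℝ (Fin n)) : ℝ :=
  (1 / 2 : ℝ) * ∑ l, (G y)⁻¹ k l *
    (pderiv i (fun z => G z j l) y + pderiv j (fun z => G z i l) y
      - pderiv l (fun z => G z i j) y)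

/-- The component
`Rˡₖᵢⱼ = ∂ᵢΓˡⱼₖ - ∂ⱼΓˡᵢₖ + ∑ₚ (Γˡᵢₚ Γᵖⱼₖ - Γˡⱼₚ Γᵖᵢₖ)` of the Riemann curvature tensor. -/
def riemann (G : EuclideanSpace ℝ (Fin n) → Matrix (Fin n) (Fin n) ℝ) (l k i j : Fin n)
    (y : EuclideanSpace ℝ (Fin n)) : ℝ :=
  pderiv i (christoffel G l j k) y - pderiv j (christoffel G l i k) y
    + ∑ p, (christoffel G l i p y * christoffel G p j k y
      - christoffel G l j p y * christoffel G p i k y)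

/-- The Ricci curvature `Rₖⱼ = ∑ᵢ Rⁱₖᵢⱼ`. -/
def ricci (G : EuclideanSpace ℝ (Fin n) → Matrix (Fin n) (Fin n) ℝ) (k j : Fin n)
    (y : EuclideanSpace ℝ (Fin n)) : ℝ :=
  ∑ i, riemann G i k i j y

/-- The scalar curvature `∑ₖⱼ Gᵏʲ Rₖⱼ`; it equals `n (n - 1)` on the unit sphere. -/
def coordScalar (G : EuclideanSpace ℝ (Fin n) → Matrix (Fin n) (Fin n) ℝ)
    (y : EuclideanSpace ℝ (Fin n)) : ℝ :=
  ∑ k, ∑ j, (G y)⁻¹ k j * ricci G k j y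

/-- The Laplace-Beltrami operator `∑ᵢⱼ Gⁱʲ (∂ᵢ∂ⱼU - ∑ₖ Γᵏᵢⱼ ∂ₖU)` (non-positive sign
convention). -/
def coordLaplacian (G : EuclideanSpace ℝ (Fin n) → Matrix (Fin n) (Fin n) ℝ)
    (U : EuclideanSpace ℝ (Fin n) → ℝ) (y : EuclideanSpace ℝ (Fin n)) : ℝ :=
  ∑ i, ∑ j, (G y)⁻¹ i j *
    (pderiv i (pderiv j U) y - ∑ k, christoffel G k i j y * pderiv k U y)

end Coordinates

section ManifoldDefs

/-! ### Riemannian geometry of a manifold -/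

variable {n : ℕ} {M : Type*} [TopologicalSpace M] [ChartedSpace (EuclideanSpace ℝ (Fin n)) M]

variable (n M) in
/-- A field of bilinear forms on the tangent spaces of `M`. -/
abbrev BilinField : Type _ :=
  ∀ p : M, TangentSpace (𝓡 n) p →L[ℝ] TangentSpace (𝓡 n) p →L[ℝ] ℝ

/-- The coordinate vector field `∂ᵢ` of the chart around `x`, at the point with coordinates `y`. -/
def coordVec (x : M) (i : Fin n) (y : EuclideanSpace ℝ (Fin n)) :
    TangentSpace (𝓡 n) ((extChartAt (𝓡 n) x).symm y) :=
  mfderivWithin 𝓘(ℝ, EuclideanSpace ℝ (Fin n)) (𝓡 n) (extChartAt (𝓡 n) x).symm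
    (Set.range (𝓡 n)) y (EuclideanSpace.single i (1 : ℝ) : EuclideanSpace ℝ (Fin n))

/-- The matrix `Gᵢⱼ = g(∂ᵢ, ∂ⱼ)` of `g` in the chart around `x`. -/
def metricMatrix (g : BilinField n M) (x : M) (y : EuclideanSpace ℝ (Fin n)) :
    Matrix (Fin n) (Fin n) ℝ :=
  Matrix.of fun i j => g ((extChartAt (𝓡 n) x).symm y) (coordVec x i y) (coordVec x j y)

/-- The scalar curvature of `g` at `p`, computed in the chart around `p` (the value does not depend
on the chart). -/
def scalarCurvature (g : BilinField n M) (p : M) : ℝ :=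
  coordScalar (metricMatrix g p) (extChartAt (𝓡 n) p p)

/-- The Laplace-Beltrami operator of `g` applied to `w`, at `p`. -/
def laplacian (g : BilinField n M) (w : M → ℝ) (p : M) : ℝ :=
  coordLaplacian (metricMatrix g p) (w ∘ (extChartAt (𝓡 n) p).symm) (extChartAt (𝓡 n) p p)

variable [IsManifold (𝓡 n) ∞ M] [T2Space M] [SigmaCompactSpace M]

variable (n M) in
/-- A smooth partition of unity subordinate to the charts. -/
def chartPartition : SmoothPartitionOfUnity M (𝓡 n) M Set.univ :=
  (SmoothPartitionOfUnity.exists_isSubordinate_chartAt_source (𝓡 n) M).choose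

variable (n M) in
theorem chartPartition_isSubordinate :
    (chartPartition n M).IsSubordinate
      (fun x => (chartAt (EuclideanSpace ℝ (Fin n)) x).source) :=
  (SmoothPartitionOfUnity.exists_isSubordinate_chartAt_source (𝓡 n) M).choose_spec

/-- The measure `√(det G) dy` on the domain of the chart around `x`, as a measure on `M`. -/
def chartVolume [MeasurableSpace M] (g : BilinField n M) (x : M) : Measure M :=
  (((volume : Measure (EuclideanSpace ℝ (Fin n))).restrict
      (extChartAt (𝓡 n) x).target).withDensity
    (fun y => ENNReal.ofReal (Real.sqrt (metricMatrix g x y).det))).map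
      (extChartAt (𝓡 n) x).symm

/-- The Riemannian volume measure of `g`: with `(ρₓ)` a partition of unity subordinate to the
charts, `∫ φ dVol = ∑ₓ ∫ ρₓ φ √(det G) dy` (the value does not depend on the partition). -/
def riemVolume [MeasurableSpace M] (g : BilinField n M) : Measure M :=
  Measure.sum fun x : M =>
    (chartVolume g x).withDensity fun p => ENNReal.ofReal (chartPartition n M x p)

/-- The conformal metric `w^(4/(n-2)) g`. -/
def conformal (g : BilinField n M) (w : M → ℝ) : BilinField n M :=
  fun p => (w p ^ ((4 : ℝ) / ((n : ℝ) - 2))) • g p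

/-- The mean value `Vol_g⁻¹ ∫ f(S(g)) dVol_g`. -/
def averageOfScalar [MeasurableSpace M] (f : ℝ → ℝ) (g : BilinField n M) : ℝ :=
  ((riemVolume g).real Set.univ)⁻¹ * ∫ p, f (scalarCurvature g p) ∂(riemVolume g)

/-- The time interval `[0, T)`, where `T = ∞` is allowed. -/
def timeInterval (T : EReal) : Set ℝ := {t : ℝ | 0 ≤ t ∧ (t : EReal) < T}

/-- `u` is a solution on `[0, T) × M` of the generalized Yamabe flow
`∂ₜ g = (f(S) - A) g`, `g(t) = u(t)^(4/(n-2)) g₀`, `g(0) = u₀^(4/(n-2)) g₀`. The regularity asked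
for is: `u` is positive, each `u(t)` is `C²`, and `u` and `Δ₀u` are continuous on `[0, T) × M`.
The evolution equation is an identity of bilinear forms; at `t = 0` the derivative is one-sided. -/
structure IsGeneralizedYamabeFlow [MeasurableSpace M] (g₀ : BilinField n M) (f : ℝ → ℝ)
    (u₀ : M → ℝ) (T : EReal) (u : ℝ → M → ℝ) : Prop where
  pos : ∀ t ∈ timeInterval T, ∀ p, 0 < u t p
  contMDiff : ∀ t ∈ timeInterval T, ContMDiff (𝓡 n) 𝓘(ℝ, ℝ) 2 (u t)
  continuousOn : ContinuousOn (fun z : ℝ × M => u z.1 z.2) (timeInterval T ×ˢ Set.univ)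
  continuousOn_laplacian :
    ContinuousOn (fun z : ℝ × M => laplacian g₀ (u z.1) z.2) (timeInterval T ×ˢ Set.univ)
  initial : u 0 = u₀
  evolution : ∀ t ∈ timeInterval T, ∀ (p : M) (v w : TangentSpace (𝓡 n) p),
    HasDerivWithinAt (fun s => conformal g₀ (u s) p v w)
      ((f (scalarCurvature (conformal g₀ (u t)) p) - averageOfScalar f (conformal g₀ (u t)))
        * conformal g₀ (u t) p v w)
      (timeInterval T) t

end ManifoldDefs

end YamabeFlow

end

/-!
Write `S` for the scalar curvature of `g = u^(4/(n-2)) g₀`, and put `k = (n-2)/4`, `κ = 4/(n-2)`.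
Since `g₀` is scalar flat, the conformal change formula (`IsMetricAt.coordScalar_rpow_smul`,
`scalarCurvature_conformal`) gives `S = -c u^(-κ) Δ₀u / u` with `c > 0`. The flow is
`∂ₜ log u = k (f(S) - A)`. As `S` is only continuous in `(t, p)`, its own evolution equation is not
available; apart from the conservation of volume, the arguments are maximum principles for the
function `log u`, which is differentiable in time (`IsFlow` collects what they use).

*Space.* By the second derivative test (`laplacian_le_of_isMax`), if `p` is a maximum of
`u(t) / u(s)`, with value `m`, then `S(t, p) ≥ m^(-κ) S(s, p)`. In particular `S ≥ 0` at a maximum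
of `u` and `S ≤ 0` at a minimum. The second of these gives `S_min ≤ 0`.

*Lower bound for the curvature* (`IsFlow.le_scalar`). Let `v = log u + k ∫ A`, so that
`∂ₜv = k f(S)`. If `S_min` fell below `σ = S_min(0)`, then `k max f(S)` would rise above `k f(σ)`,
and a strictly increasing affine function `λ(t) > k f(σ)` could be chosen such that
`k max f(S) ≤ λ + γ`, with the small gap `γ` attained. At a maximum `(s, t, p)`, `s < t`, of
`v(t, p) - v(s, p) - ∫ₛᵗ λ` one has `k f(S(s, p)) = λ(s)` and `k f(S(t, p)) ≥ λ(t)`. On the other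
hand `A ≤ max f(S)` shows that `log (u(t, p) / u(s, p)) ≥ -γ (t - s)`, and as `S(s, p) ≤ 0` the
comparison in space bounds `S(t, p) - S(s, p)` below by a multiple of `-γ (t - s)`. As `f` is
decreasing and locally Lipschitz, `λ(t) - λ(s)` is at most a multiple of `γ (t - s)`: a
contradiction when `γ` is small compared with the slope of `λ`.

*Bounds for `u`* (`IsFlow.abs_log_le`). By the signs of `S` at the extrema of `u`, the maximum of
`v - k f(0) t` does not increase and its minimum does not decrease; so the oscillation of `log u`
on `M` does not increase (`IsFlow.sub_le_of_initial`). The volume `∫ u^(2n/(n-2)) dVol₀` is constant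
(`IsFlow.integral_exp_eq`), so `u(t)` is neither everywhere larger nor everywhere smaller than
`u₀`. Together these bound `u` from above and below in terms of `u₀` alone. Connectedness of `M` is
not needed, because the oscillation is taken over all of `M`.
-/

namespace YamabeFlow

open Filter Topology

/-! ### Calculus of partial derivatives and metrics in coordinates -/

section CoordinateCalculus

variable {n : ℕ} {F H : EuclideanSpace ℝ (Fin n) → ℝ} {y : EuclideanSpace ℝ (Fin n)}

theorem pderiv_congr (h : F =ᶠ[𝓝 y] H) (i : Fin n) :
    pderiv i F y = pderiv i H y := by
  simp only [pderiv, h.fderiv_eq]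

theorem pderiv_const (i : Fin n) (c : ℝ) : pderiv i (fun _ => c) y = 0 := by
  simp [pderiv]

theorem pderiv_add (hF : DifferentiableAt ℝ F y)
    (hH : DifferentiableAt ℝ H y) (i : Fin n) :
    pderiv i (fun z => F z + H z) y = pderiv i F y + pderiv i H y := by
  simp only [pderiv, fderiv_fun_add hF hH, _root_.add_apply]

theorem pderiv_sub (hF : DifferentiableAt ℝ F y)
    (hH : DifferentiableAt ℝ H y) (i : Fin n) :
    pderiv i (fun z => F z - H z) y = pderiv i F y - pderiv i H y := by
  simp only [pderiv, fderiv_fun_sub hF hH, _root_.sub_apply]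

theorem pderiv_mul (hF : DifferentiableAt ℝ F y)
    (hH : DifferentiableAt ℝ H y) (i : Fin n) :
    pderiv i (fun z => F z * H z) y = pderiv i F y * H y + F y * pderiv i H y := by
  simp only [pderiv, fderiv_fun_mul hF hH, _root_.add_apply,
    _root_.smul_apply, smul_eq_mul]
  ring

theorem pderiv_const_mul (hF : DifferentiableAt ℝ F y) (c : ℝ)
    (i : Fin n) : pderiv i (fun z => c * F z) y = c * pderiv i F y := by
  rw [pderiv_mul (differentiableAt_const c) hF, pderiv_const]; ring

theorem pderiv_sum {ι : Type*} (s : Finset ι) {F : ι → EuclideanSpace ℝ (Fin n) → ℝ}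
    (hF : ∀ a ∈ s, DifferentiableAt ℝ (F a) y) (i : Fin n) :
    pderiv i (fun z => ∑ a ∈ s, F a z) y = ∑ a ∈ s, pderiv i (F a) y := by
  simp only [pderiv, fderiv_fun_sum hF, _root_.sum_apply]

/-- Chain rule for the composition with a function of one real variable. -/
theorem pderiv_comp {θ : ℝ → ℝ} {θ' : ℝ} (hθ : HasDerivAt θ θ' (F y))
    (hF : DifferentiableAt ℝ F y) (i : Fin n) :
    pderiv i (fun z => θ (F z)) y = θ' * pderiv i F y := by
  have := (hθ.comp_hasFDerivAt y hF.hasFDerivAt).fderiv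
  simp only [pderiv]
  rw [show (fun z => θ (F z)) = θ ∘ F from rfl, this]
  simp

theorem contDiffAt_pderiv {m k : ℕ∞ω} (hF : ContDiffAt ℝ k F y)
    (hmk : m + 1 ≤ k) (i : Fin n) : ContDiffAt ℝ m (pderiv i F) y :=
  (hF.fderiv_right hmk).clm_apply contDiffAt_const

theorem contDiffAt_matrix_det {ι : Type*} [Fintype ι] [DecidableEq ι] {k : ℕ∞ω}
    {G : EuclideanSpace ℝ (Fin n) → Matrix ι ι ℝ}
    (hG : ∀ i j, ContDiffAt ℝ k (fun z => G z i j) y) : ContDiffAt ℝ k (fun z => (G z).det) y := by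
  simp only [Matrix.det_apply]
  refine ContDiffAt.sum fun σ _ => ContDiffAt.const_smul _ ?_
  exact contDiffAt_prod fun i _ => hG _ _

theorem contDiffAt_matrix_inv {k : ℕ∞ω} {G : EuclideanSpace ℝ (Fin n) → Matrix (Fin n) (Fin n) ℝ}
    (hG : ∀ i j, ContDiffAt ℝ k (fun z => G z i j) y) (hdet : (G y).det ≠ 0) (i j : Fin n) :
    ContDiffAt ℝ k (fun z => (G z)⁻¹ i j) y := by
  simp only [Matrix.inv_def, Matrix.smul_apply, Ring.inverse_eq_inv', smul_eq_mul,
    Matrix.adjugate_apply]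
  refine ((contDiffAt_matrix_det hG).inv hdet).mul (contDiffAt_matrix_det fun a b => ?_)
  by_cases h : a = j
  · subst h; simpa using contDiffAt_const
  · simpa [Matrix.updateRow_ne h] using hG a b

/-- The hypotheses under which the curvature formulas are used: near `y` the matrix `G` is
symmetric, and at `y` it is twice continuously differentiable and invertible. -/
structure IsMetricAt (G : EuclideanSpace ℝ (Fin n) → Matrix (Fin n) (Fin n) ℝ)
    (y : EuclideanSpace ℝ (Fin n)) : Prop where
  contDiffAt : ∀ i j, ContDiffAt ℝ 2 (fun z => G z i j) y
  symm : ∀ᶠ z in 𝓝 y, (G z).IsSymm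
  det_ne_zero : (G y).det ≠ 0

namespace IsMetricAt

variable {G : EuclideanSpace ℝ (Fin n) → Matrix (Fin n) (Fin n) ℝ}

theorem eventually (hG : IsMetricAt G y) : ∀ᶠ z in 𝓝 y, IsMetricAt G z := by
  have h1 : ∀ᶠ z in 𝓝 y, ∀ i j, ContDiffAt ℝ 2 (fun z => G z i j) z := by
    simp only [eventually_all]
    exact fun i j => (hG.contDiffAt i j).eventually (by simp)
  have h2 := (contDiffAt_matrix_det hG.contDiffAt).continuousAt.eventually_ne hG.det_ne_zero
  filter_upwards [h1, h2, hG.symm.eventually_nhds] with z a b c using ⟨a, c, b⟩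

theorem contDiffAt_inv (hG : IsMetricAt G y) (i j : Fin n) :
    ContDiffAt ℝ 2 (fun z => (G z)⁻¹ i j) y :=
  contDiffAt_matrix_inv hG.contDiffAt hG.det_ne_zero i j

theorem inv_symm (hG : IsMetricAt G y) (i j : Fin n) : (G y)⁻¹ i j = (G y)⁻¹ j i := by
  have h : (G y)⁻¹.transpose = (G y)⁻¹ := by
    rw [Matrix.transpose_nonsing_inv, hG.symm.self_of_nhds]
  conv_lhs => rw [← h]
  rfl

theorem apply_symm (hG : IsMetricAt G y) (i j : Fin n) : G y i j = G y j i :=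
  hG.symm.self_of_nhds.apply j i

theorem sum_inv_mul (hG : IsMetricAt G y) (i j : Fin n) :
    ∑ a, (G y)⁻¹ i a * G y a j = if i = j then 1 else 0 := by
  rw [← Matrix.mul_apply, Matrix.nonsing_inv_mul _ hG.det_ne_zero.isUnit, Matrix.one_apply]

theorem sum_mul_inv (hG : IsMetricAt G y) (i j : Fin n) :
    ∑ a, G y i a * (G y)⁻¹ a j = if i = j then 1 else 0 := by
  rw [← Matrix.mul_apply, Matrix.mul_nonsing_inv _ hG.det_ne_zero.isUnit, Matrix.one_apply]

theorem pderiv_symm (hG : IsMetricAt G y) (i j k : Fin n) :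
    pderiv i (fun z => G z j k) y = pderiv i (fun z => G z k j) y :=
  pderiv_congr (hG.symm.mono fun _ hz => hz.apply k j) i

theorem contDiffAt_christoffel (hG : IsMetricAt G y) (k i j : Fin n) :
    ContDiffAt ℝ 1 (christoffel G k i j) y := by
  have h (a b c) : ContDiffAt ℝ 1 (pderiv a (fun z => G z b c)) y :=
    contDiffAt_pderiv (hG.contDiffAt b c) (by norm_num) a
  unfold christoffel
  refine contDiffAt_const.mul (ContDiffAt.sum fun l _ => ?_)
  exact ((hG.contDiffAt_inv k l).of_le (by norm_num)).mul (((h _ _ _).add (h _ _ _)).sub (h _ _ _))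

theorem christoffel_symm (hG : IsMetricAt G y) (k i j : Fin n) :
    christoffel G k i j y = christoffel G k j i y := by
  unfold christoffel
  congr 1
  refine Finset.sum_congr rfl fun l _ => ?_
  rw [hG.pderiv_symm l i j]; ring

end IsMetricAt

end CoordinateCalculus

/-! ### The algebra of conformal changes -/

section TensorAlgebra

variable {ι : Type*}

section Trace

variable [Fintype ι]

/-- The quadratic terms in the Ricci curvature of a connection, traced with `h`:
`hᵏʲ (Xⁱᵢₚ Yᵖⱼₖ - Xⁱⱼₚ Yᵖᵢₖ)`. -/
def quadTrace (h : ι → ι → ℝ) (X Y : ι → ι → ι → ℝ) : ℝ :=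
  ∑ k, ∑ j, h k j * ∑ i, ∑ p, (X i i p * Y p j k - X i j p * Y p i k)

/-- Polarization of `quadTrace`. -/
theorem quadTrace_add (h : ι → ι → ℝ) (X Y : ι → ι → ι → ℝ) :
    quadTrace h (fun a b c => X a b c + Y a b c) (fun a b c => X a b c + Y a b c)
      = quadTrace h X X + quadTrace h X Y + quadTrace h Y X + quadTrace h Y Y := by
  simp only [quadTrace, ← Finset.sum_add_distrib, ← mul_add]
  refine Finset.sum_congr rfl fun k _ => Finset.sum_congr rfl fun j _ => ?_
  congr 1
  exact Finset.sum_congr rfl fun i _ => Finset.sum_congr rfl fun p _ => by ring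

theorem quadTrace_eq (h : ι → ι → ℝ) (X Y : ι → ι → ι → ℝ) :
    quadTrace h X Y = ∑ p, (∑ i, X i i p) * (∑ k, ∑ j, h k j * Y p j k)
      - ∑ k, ∑ j, h k j * ∑ i, ∑ p, X i j p * Y p i k := by
  simp only [quadTrace, Finset.sum_sub_distrib, mul_sub]
  congr 1
  simp only [Finset.mul_sum, Finset.sum_mul]
  calc _ = ∑ k, ∑ p, ∑ i, ∑ j, h k j * (X i i p * Y p j k) := by
        refine Finset.sum_congr rfl fun k _ => ?_
        rw [Finset.sum_comm_cycle]
        exact Finset.sum_congr rfl fun p _ => Finset.sum_comm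
    _ = ∑ p, ∑ k, ∑ i, ∑ j, h k j * (X i i p * Y p j k) := Finset.sum_comm
    _ = _ := by
        refine Finset.sum_congr rfl fun p _ => Finset.sum_congr rfl fun k _ => ?_
        rw [Finset.sum_comm]
        exact Finset.sum_congr rfl fun j _ => Finset.sum_congr rfl fun i _ => by ring

end Trace

variable [DecidableEq ι]

/-- The tensor `δᵏᵢ φⱼ + δᵏⱼ φᵢ - gᵢⱼ ψᵏ`, by which the Christoffel symbols of `e^(2φ) g` differ
from those of `g` when `φᵢ` are the components of `dφ` and `ψᵏ` those of `grad φ`. -/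
def conformalDiff (g : ι → ι → ℝ) (φ ψ : ι → ℝ) (k i j : ι) : ℝ :=
  (if k = i then φ j else 0) + (if k = j then φ i else 0) - g i j * ψ k

theorem conformalDiff_symm {g : ι → ι → ℝ} (hg : ∀ i j, g i j = g j i) (φ ψ : ι → ℝ)
    (k i j : ι) : conformalDiff g φ ψ k i j = conformalDiff g φ ψ k j i := by
  unfold conformalDiff; rw [hg i j]; ring

variable [Fintype ι] {g h : ι → ι → ℝ} {φ ψ : ι → ℝ}

/-- The trace `Dⁱᵢₚ = n φₚ`. -/
theorem sum_conformalDiff_trace (hψ : ∀ k, ∑ i, g i k * ψ i = φ k) (p : ι) :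
    ∑ i, conformalDiff g φ ψ i i p = Fintype.card ι * φ p := by
  simp [conformalDiff, Finset.sum_add_distrib, hψ]

/-- The contraction `hᵏʲ Dᵖⱼₖ = (2 - n) ψᵖ`. -/
theorem sum_inv_mul_conformalDiff (hh : ∀ i j, h i j = h j i)
    (hgh : ∑ k, ∑ j, h k j * g j k = Fintype.card ι)
    (hψ : ∀ k, ψ k = ∑ l, h k l * φ l) (p : ι) :
    ∑ k, ∑ j, h k j * conformalDiff g φ ψ p j k = (2 - Fintype.card ι) * ψ p := by
  have e : ∑ k, ∑ j, h k j * (g j k * ψ p) = Fintype.card ι * ψ p := by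
    rw [← hgh, Finset.sum_mul]
    refine Finset.sum_congr rfl fun k _ => ?_
    rw [Finset.sum_mul]
    exact Finset.sum_congr rfl fun j _ => by ring
  have e2 : ∑ k, h k p * φ k = ψ p := by
    rw [hψ]; exact Finset.sum_congr rfl fun k _ => by rw [hh]
  simp only [conformalDiff, mul_sub, mul_add, Finset.sum_sub_distrib, Finset.sum_add_distrib, e]
  simp [e2, ← hψ]
  ring

/-- The contraction `hᵏʲ Dᵖᵢₖ = δᵖᵢ ψʲ + φᵢ hᵖʲ - δʲᵢ ψᵖ`. -/
theorem sum_inv_mul_conformalDiff_single (hh : ∀ i j, h i j = h j i)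
    (hgh : ∀ i j, ∑ k, h i k * g k j = if i = j then 1 else 0) (hg : ∀ i j, g i j = g j i)
    (hψ : ∀ k, ψ k = ∑ l, h k l * φ l) (p i j : ι) :
    ∑ k, h k j * conformalDiff g φ ψ p i k
      = (if p = i then ψ j else 0) + φ i * h p j - (if j = i then ψ p else 0) := by
  have e : ∑ k, h k j * (g i k * ψ p) = (if j = i then 1 else 0) * ψ p := by
    rw [← hgh, Finset.sum_mul]
    exact Finset.sum_congr rfl fun k _ => by rw [hh, hg]; ring
  have e2 : ∑ k, h k j * φ k = ψ j := by
    rw [hψ]; exact Finset.sum_congr rfl fun k _ => by rw [hh]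
  simp only [conformalDiff, mul_sub, mul_add, Finset.sum_sub_distrib, Finset.sum_add_distrib, e]
  by_cases hp : p = i <;> simp [hp, e2, mul_comm (φ i)]

/-- For a symmetric `X`, `hᵏʲ Xⁱⱼₚ Dᵖᵢₖ` is a combination of the two contractions of `X`. -/
theorem sum_inv_mul_mul_conformalDiff (hh : ∀ i j, h i j = h j i)
    (hgh : ∀ i j, ∑ k, h i k * g k j = if i = j then 1 else 0) (hg : ∀ i j, g i j = g j i)
    (hψ : ∀ k, ψ k = ∑ l, h k l * φ l) (X : ι → ι → ι → ℝ) (hX : ∀ k i j, X k i j = X k j i) :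
    ∑ k, ∑ j, h k j * ∑ i, ∑ p, X i j p * conformalDiff g φ ψ p i k
      = ∑ i, φ i * ∑ k, ∑ j, h k j * X i j k := by
  have e : ∀ j, ∑ k, h k j * ∑ i, ∑ p, X i j p * conformalDiff g φ ψ p i k
      = ∑ i, ∑ p, X i j p * ((if p = i then ψ j else 0) + φ i * h p j
          - (if j = i then ψ p else 0)) := fun j => by
    simp only [Finset.mul_sum]
    rw [Finset.sum_comm]
    refine Finset.sum_congr rfl fun i _ => ?_
    rw [Finset.sum_comm]
    refine Finset.sum_congr rfl fun p _ => ?_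
    rw [← sum_inv_mul_conformalDiff_single hh hgh hg hψ, Finset.mul_sum]
    exact Finset.sum_congr rfl fun k _ => by ring
  rw [Finset.sum_comm]
  simp only [e, mul_sub, mul_add, Finset.sum_sub_distrib, Finset.sum_add_distrib]
  have e1 : ∑ j, ∑ i, ∑ p, X i j p * (if p = i then ψ j else 0) = ∑ j, ∑ i, X i j i * ψ j := by
    simp
  have e2 : ∑ j, ∑ i, ∑ p, X i j p * (if j = i then ψ p else 0) = ∑ j, ∑ i, X i j i * ψ j := by
    have : ∀ j, ∑ i, ∑ p, X i j p * (if j = i then ψ p else 0) = ∑ p, X j j p * ψ p := fun j => by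
      rw [Finset.sum_eq_single j] <;> simp +contextual [eq_comm]
    simp only [this]
    rw [Finset.sum_comm]
    exact Finset.sum_congr rfl fun p _ => Finset.sum_congr rfl fun j _ => by rw [hX]
  rw [e1, e2]
  rw [add_sub_cancel_left]
  simp only [Finset.mul_sum]
  rw [Finset.sum_comm]
  refine Finset.sum_congr rfl fun i _ => ?_
  rw [Finset.sum_comm]
  exact Finset.sum_congr rfl fun k _ => Finset.sum_congr rfl fun j _ => by ring

theorem quadTrace_conformalDiff_right (hh : ∀ i j, h i j = h j i)
    (hgh : ∀ i j, ∑ k, h i k * g k j = if i = j then 1 else 0) (hg : ∀ i j, g i j = g j i)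
    (hψ : ∀ k, ψ k = ∑ l, h k l * φ l) (X : ι → ι → ι → ℝ) (hX : ∀ k i j, X k i j = X k j i) :
    quadTrace h X (conformalDiff g φ ψ)
      = (2 - Fintype.card ι) * ∑ p, (∑ i, X i i p) * ψ p
        - ∑ i, φ i * ∑ k, ∑ j, h k j * X i j k := by
  have hgh' : ∑ k, ∑ j, h k j * g j k = Fintype.card ι := by simp [hgh]
  rw [quadTrace_eq, sum_inv_mul_mul_conformalDiff hh hgh hg hψ X hX]
  simp only [sum_inv_mul_conformalDiff hh hgh' hψ, Finset.mul_sum]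
  congr 1
  exact Finset.sum_congr rfl fun p _ => by ring

theorem quadTrace_conformalDiff_left (hh : ∀ i j, h i j = h j i)
    (hgh : ∀ i j, ∑ k, h i k * g k j = if i = j then 1 else 0) (hg : ∀ i j, g i j = g j i)
    (hψ : ∀ k, ψ k = ∑ l, h k l * φ l) (hφ : ∀ k, ∑ i, g i k * ψ i = φ k)
    (X : ι → ι → ι → ℝ) (hX : ∀ k i j, X k i j = X k j i) :
    quadTrace h (conformalDiff g φ ψ) X
      = (Fintype.card ι - 1) * ∑ i, φ i * ∑ k, ∑ j, h k j * X i j k := by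
  rw [quadTrace_eq]
  have e : ∑ k, ∑ j, h k j * ∑ i, ∑ p, conformalDiff g φ ψ i j p * X p i k
      = ∑ i, φ i * ∑ k, ∑ j, h k j * X i j k := by
    rw [← sum_inv_mul_mul_conformalDiff hh hgh hg hψ X hX, Finset.sum_comm]
    refine Finset.sum_congr rfl fun k _ => Finset.sum_congr rfl fun j _ => ?_
    rw [hh j k, Finset.sum_comm]
    congr 1
    refine Finset.sum_congr rfl fun i _ => Finset.sum_congr rfl fun p _ => ?_
    rw [conformalDiff_symm hg, hX]; ring
  rw [e]
  simp only [sum_conformalDiff_trace hφ]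
  rw [sub_mul, one_mul, Finset.mul_sum]
  congr 1
  exact Finset.sum_congr rfl fun p _ => by ring

theorem quadTrace_conformalDiff_self (hh : ∀ i j, h i j = h j i)
    (hgh : ∀ i j, ∑ k, h i k * g k j = if i = j then 1 else 0) (hg : ∀ i j, g i j = g j i)
    (hψ : ∀ k, ψ k = ∑ l, h k l * φ l) (hφ : ∀ k, ∑ i, g i k * ψ i = φ k) :
    quadTrace h (conformalDiff g φ ψ) (conformalDiff g φ ψ)
      = -((Fintype.card ι - 1) * (Fintype.card ι - 2)) * ∑ i, φ i * ψ i := by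
  have hgh' : ∑ k, ∑ j, h k j * g j k = Fintype.card ι := by simp [hgh]
  rw [quadTrace_conformalDiff_left hh hgh hg hψ hφ _ (conformalDiff_symm hg φ ψ)]
  simp only [sum_inv_mul_conformalDiff hh hgh' hψ, Finset.mul_sum]
  exact Finset.sum_congr rfl fun p _ => by ring

end TensorAlgebra

/-! ### Christoffel symbols under a conformal change -/

section ConformalChange

variable {n : ℕ} {G : EuclideanSpace ℝ (Fin n) → Matrix (Fin n) (Fin n) ℝ}
  {φ : EuclideanSpace ℝ (Fin n) → ℝ} {y : EuclideanSpace ℝ (Fin n)}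

/-- The component `φᵏ = ∑ₗ Gᵏˡ ∂ₗφ` of the gradient of `φ`. -/
noncomputable def coordGradient (G : EuclideanSpace ℝ (Fin n) → Matrix (Fin n) (Fin n) ℝ)
    (φ : EuclideanSpace ℝ (Fin n) → ℝ) (k : Fin n) (y : EuclideanSpace ℝ (Fin n)) : ℝ :=
  ∑ l, (G y)⁻¹ k l * pderiv l φ y

/-- The scalar curvature split into the terms with derivatives of the Christoffel symbols and the
terms quadratic in them. -/
theorem coordScalar_eq (G : EuclideanSpace ℝ (Fin n) → Matrix (Fin n) (Fin n) ℝ)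
    (y : EuclideanSpace ℝ (Fin n)) :
    coordScalar G y = ∑ k, ∑ j, (G y)⁻¹ k j *
        ((∑ i, pderiv i (christoffel G i j k) y) - ∑ i, pderiv j (christoffel G i i k) y)
      + quadTrace (fun i j => (G y)⁻¹ i j) (fun k i j => christoffel G k i j y)
        (fun k i j => christoffel G k i j y) := by
  simp only [coordScalar, ricci, riemann, quadTrace, ← Finset.sum_add_distrib,
    ← Finset.sum_sub_distrib, ← mul_add]

namespace IsMetricAt

theorem sum_mul_coordGradient (hG : IsMetricAt G y) (φ : EuclideanSpace ℝ (Fin n) → ℝ)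
    (k : Fin n) : ∑ i, G y i k * coordGradient G φ i y = pderiv k φ y := by
  simp only [fun i => hG.apply_symm i k]
  simp only [coordGradient, Finset.mul_sum]
  rw [Finset.sum_comm]
  simp only [← mul_assoc, ← Finset.sum_mul, hG.sum_mul_inv]
  simp

theorem contDiffAt_coordGradient (hG : IsMetricAt G y) (hφ : ContDiffAt ℝ 2 φ y) (k : Fin n) :
    ContDiffAt ℝ 1 (coordGradient G φ k) y := by
  unfold coordGradient
  exact ContDiffAt.sum fun l _ => ((hG.contDiffAt_inv k l).of_le (by norm_num)).mul
    (contDiffAt_pderiv hφ (by norm_num) l)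

theorem inv_exp_smul (G : EuclideanSpace ℝ (Fin n) → Matrix (Fin n) (Fin n) ℝ)
    (hG : (G y).det ≠ 0) (i j : Fin n) :
    (Real.exp (2 * φ y) • G y)⁻¹ i j = Real.exp (-(2 * φ y)) * (G y)⁻¹ i j := by
  have := Matrix.inv_smul' (G y) (Units.mk0 (Real.exp (2 * φ y)) (Real.exp_pos _).ne')
    hG.isUnit
  have h2 : (Real.exp (2 * φ y) • G y)⁻¹ = (Real.exp (2 * φ y))⁻¹ • (G y)⁻¹ := this
  rw [h2, Real.exp_neg]; rfl

/-- The Christoffel symbols of `e^(2φ) G`. -/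
theorem christoffel_exp_smul (hG : IsMetricAt G y) (hφ : DifferentiableAt ℝ φ y)
    (k i j : Fin n) :
    christoffel (fun z => Real.exp (2 * φ z) • G z) k i j y = christoffel G k i j y
      + conformalDiff (G y) (fun l => pderiv l φ y) (fun l => coordGradient G φ l y) k i j := by
  have hd (a b c : Fin n) : pderiv a (fun z => (Real.exp (2 * φ z) • G z) b c) y
      = Real.exp (2 * φ y) * (2 * pderiv a φ y * G y b c + pderiv a (fun z => G z b c) y) := by
    simp only [Matrix.smul_apply, smul_eq_mul]
    have h2 : DifferentiableAt ℝ (fun z => 2 * φ z) y := hφ.const_mul 2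
    rw [pderiv_mul h2.exp ((hG.contDiffAt b c).differentiableAt (by norm_num)),
      pderiv_comp (Real.hasDerivAt_exp _) h2, pderiv_const_mul hφ]
    ring
  have e : Real.exp (-(2 * φ y)) * Real.exp (2 * φ y) = 1 := by rw [← Real.exp_add]; simp
  have t (a b : Fin n) (c : ℝ) : ∑ l, (G y)⁻¹ a l * G y b l * c = if a = b then c else 0 := by
    rw [← Finset.sum_mul, Finset.sum_congr rfl fun l _ => by rw [hG.apply_symm b l],
      hG.sum_inv_mul]
    simp
  have e1 : ∑ l, (G y)⁻¹ k l * (pderiv i φ y * G y j l) = if k = j then pderiv i φ y else 0 := by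
    rw [← t k j (pderiv i φ y)]
    exact Finset.sum_congr rfl fun l _ => by ring
  have e2 : ∑ l, (G y)⁻¹ k l * (pderiv j φ y * G y i l) = if k = i then pderiv j φ y else 0 := by
    rw [← t k i (pderiv j φ y)]
    exact Finset.sum_congr rfl fun l _ => by ring
  have e3 : ∑ l, (G y)⁻¹ k l * (pderiv l φ y * G y i j) = G y i j * coordGradient G φ k y := by
    rw [coordGradient, Finset.mul_sum]
    exact Finset.sum_congr rfl fun l _ => by ring
  unfold conformalDiff
  beta_reduce
  rw [← e1, ← e2, ← e3]
  simp only [christoffel, hd, inv_exp_smul G hG.det_ne_zero, Finset.mul_sum]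
  rw [← Finset.sum_add_distrib, ← Finset.sum_sub_distrib, ← Finset.sum_add_distrib]
  refine Finset.sum_congr rfl fun l _ => ?_
  linear_combination (1 / 2 * (G y)⁻¹ k l * ((2 * pderiv i φ y * G y j l
    + pderiv i (fun z => G z j l) y) + (2 * pderiv j φ y * G y i l + pderiv j (fun z => G z i l) y)
    - (2 * pderiv l φ y * G y i j + pderiv l (fun z => G z i j) y))) * e

/-- The trace `Γⁱᵢₚ = ½ Gⁱˡ ∂ₚGᵢₗ`. -/
theorem sum_christoffel_trace (hG : IsMetricAt G y) (p : Fin n) :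
    ∑ i, christoffel G i i p y
      = (1 / 2 : ℝ) * ∑ i, ∑ l, (G y)⁻¹ i l * pderiv p (fun z => G z i l) y := by
  have e : ∑ i, ∑ l, (G y)⁻¹ i l * pderiv i (fun z => G z p l) y
      = ∑ i, ∑ l, (G y)⁻¹ i l * pderiv l (fun z => G z i p) y := by
    rw [Finset.sum_comm]
    refine Finset.sum_congr rfl fun i _ => Finset.sum_congr rfl fun l _ => ?_
    rw [hG.inv_symm, hG.pderiv_symm l p i]
  simp only [christoffel, ← Finset.mul_sum, mul_sub, mul_add, Finset.sum_add_distrib,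
    Finset.sum_sub_distrib, e]
  ring

theorem sum_inv_mul_christoffel (hG : IsMetricAt G y) (p : Fin n) :
    ∑ k, ∑ j, (G y)⁻¹ k j * christoffel G p j k y
      = ∑ l, (G y)⁻¹ p l * ((∑ k, ∑ j, (G y)⁻¹ k j * pderiv j (fun z => G z k l) y)
        - ∑ i, christoffel G i i l y) := by
  have e (l : Fin n) : ∑ k, ∑ j, (G y)⁻¹ k j * pderiv k (fun z => G z j l) y
      = ∑ k, ∑ j, (G y)⁻¹ k j * pderiv j (fun z => G z k l) y := by
    rw [Finset.sum_comm]
    refine Finset.sum_congr rfl fun i _ => Finset.sum_congr rfl fun l _ => ?_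
    rw [hG.inv_symm]
  have e' (l : Fin n) : ∑ k, ∑ j, (G y)⁻¹ k j * pderiv l (fun z => G z j k) y
      = 2 * ∑ i, christoffel G i i l y := by
    rw [hG.sum_christoffel_trace, ← mul_assoc]
    norm_num
    refine Finset.sum_congr rfl fun i _ => Finset.sum_congr rfl fun j _ => ?_
    rw [hG.pderiv_symm l]
  calc _ = ∑ l, (G y)⁻¹ p l * ((1 / 2 : ℝ) * ∑ k, ∑ j, (G y)⁻¹ k j *
        (pderiv j (fun z => G z k l) y + pderiv k (fun z => G z j l) y
          - pderiv l (fun z => G z j k) y)) := by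
        simp only [christoffel, Finset.mul_sum]
        rw [Finset.sum_comm_cycle]
        refine Finset.sum_congr rfl fun l _ => Finset.sum_congr rfl fun k _ =>
          Finset.sum_congr rfl fun j _ => by ring
    _ = _ := by
        refine Finset.sum_congr rfl fun l _ => ?_
        congr 1
        simp only [mul_sub, mul_add, Finset.sum_add_distrib, Finset.sum_sub_distrib, e, e']
        ring

/-- The derivative of the inverse metric, `∂ᵢGᵏˡ = -Gᵏᵃ (∂ᵢGₐᵦ) Gᵝˡ`. -/
theorem pderiv_inv (hG : IsMetricAt G y) (i k l : Fin n) :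
    pderiv i (fun z => (G z)⁻¹ k l) y
      = - ∑ a, ∑ b, (G y)⁻¹ k a * pderiv i (fun z => G z a b) y * (G y)⁻¹ b l := by
  have hI (a b) := (hG.contDiffAt_inv a b).differentiableAt (by norm_num)
  have hD (a b) := (hG.contDiffAt a b).differentiableAt (by norm_num)
  have key (b : Fin n) : ∑ a, pderiv i (fun z => (G z)⁻¹ k a) y * G y a b
      = - ∑ a, (G y)⁻¹ k a * pderiv i (fun z => G z a b) y := by
    have h0 : pderiv i (fun z => ∑ a, (G z)⁻¹ k a * G z a b) y = 0 := by
      rw [pderiv_congr (hG.eventually.mono fun z hz => hz.sum_inv_mul k b), pderiv_const]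
    rw [pderiv_sum _ fun a _ => (hI k a).fun_mul (hD a b)] at h0
    simp only [pderiv_mul (hI _ _) (hD _ _), Finset.sum_add_distrib] at h0
    linarith
  calc _ = ∑ a, pderiv i (fun z => (G z)⁻¹ k a) y * ∑ b, G y a b * (G y)⁻¹ b l := by
        simp [hG.sum_mul_inv]
    _ = ∑ b, (∑ a, pderiv i (fun z => (G z)⁻¹ k a) y * G y a b) * (G y)⁻¹ b l := by
        simp only [Finset.mul_sum, Finset.sum_mul]
        rw [Finset.sum_comm]
        exact Finset.sum_congr rfl fun a _ => Finset.sum_congr rfl fun b _ => by ring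
    _ = _ := by
        simp only [key, neg_mul, Finset.sum_neg_distrib, Finset.sum_mul]
        rw [Finset.sum_comm]

/-- The coordinate divergence of the gradient,
`∂ᵢφⁱ = Gⁱˡ ∂ᵢ∂ₗφ - Γⁱᵢₚ φᵖ - Gᵏʲ Γᵖⱼₖ ∂ₚφ`. -/
theorem sum_pderiv_coordGradient (hG : IsMetricAt G y) (hφ : ContDiffAt ℝ 2 φ y) :
    ∑ i, pderiv i (coordGradient G φ i) y
      = ∑ i, ∑ l, (G y)⁻¹ i l * pderiv i (pderiv l φ) y
        - ∑ p, (∑ i, christoffel G i i p y) * coordGradient G φ p y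
        - ∑ p, pderiv p φ y * ∑ k, ∑ j, (G y)⁻¹ k j * christoffel G p j k y := by
  have hI (a b) := (hG.contDiffAt_inv a b).differentiableAt (by norm_num)
  have hd (a) := (contDiffAt_pderiv (m := 1) hφ (by norm_num) a).differentiableAt (by norm_num)
  have e (i : Fin n) : pderiv i (coordGradient G φ i) y
      = ∑ l, (G y)⁻¹ i l * pderiv i (pderiv l φ) y
        - ∑ a, ∑ b, (G y)⁻¹ i a * pderiv i (fun z => G z a b) y * coordGradient G φ b y := by
    unfold coordGradient
    rw [pderiv_sum _ fun a _ => (hI i a).fun_mul (hd a)]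
    simp only [pderiv_mul (hI _ _) (hd _), Finset.sum_add_distrib, hG.pderiv_inv, neg_mul,
      Finset.sum_neg_distrib]
    rw [neg_add_eq_sub]
    congr 1
    simp only [Finset.sum_mul, Finset.mul_sum]
    rw [Finset.sum_comm]
    refine Finset.sum_congr rfl fun a _ => ?_
    rw [Finset.sum_comm]
    exact Finset.sum_congr rfl fun b _ => Finset.sum_congr rfl fun c _ => by ring
  have e2 : ∑ p, pderiv p φ y * ∑ k, ∑ j, (G y)⁻¹ k j * christoffel G p j k y
      = ∑ l, coordGradient G φ l y * ((∑ k, ∑ j, (G y)⁻¹ k j * pderiv j (fun z => G z k l) y)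
        - ∑ i, christoffel G i i l y) := by
    simp only [hG.sum_inv_mul_christoffel]
    simp only [coordGradient, Finset.sum_mul]
    rw [Finset.sum_comm]
    refine Finset.sum_congr rfl fun a _ => ?_
    rw [Finset.mul_sum]
    refine Finset.sum_congr rfl fun b _ => ?_
    rw [hG.inv_symm a b]
    ring
  have e3 : ∑ i, ∑ a, ∑ b, (G y)⁻¹ i a * pderiv i (fun z => G z a b) y * coordGradient G φ b y
      = ∑ l, coordGradient G φ l y * ∑ k, ∑ j, (G y)⁻¹ k j * pderiv j (fun z => G z k l) y := by
    simp only [Finset.mul_sum]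
    rw [Finset.sum_comm_cycle]
    refine Finset.sum_congr rfl fun l _ => ?_
    rw [Finset.sum_comm]
    refine Finset.sum_congr rfl fun a _ => Finset.sum_congr rfl fun b _ => ?_
    rw [hG.inv_symm a b]
    ring
  simp only [e, Finset.sum_sub_distrib, e2, e3, mul_sub]
  have e4 : ∑ p, (∑ i, christoffel G i i p y) * coordGradient G φ p y
      = ∑ p, coordGradient G φ p y * ∑ i, christoffel G i i p y :=
    Finset.sum_congr rfl fun p _ => mul_comm _ _
  rw [e4]
  ring

end IsMetricAt
end ConformalChange

/-! ### Scalar curvature under a conformal change -/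

section ConformalLaw

variable {n : ℕ} {G : EuclideanSpace ℝ (Fin n) → Matrix (Fin n) (Fin n) ℝ}
  {φ : EuclideanSpace ℝ (Fin n) → ℝ} {y : EuclideanSpace ℝ (Fin n)}

theorem coordLaplacian_eq (G : EuclideanSpace ℝ (Fin n) → Matrix (Fin n) (Fin n) ℝ)
    (U : EuclideanSpace ℝ (Fin n) → ℝ) (y : EuclideanSpace ℝ (Fin n)) (hG : IsMetricAt G y) :
    coordLaplacian G U y = ∑ i, ∑ j, (G y)⁻¹ i j * pderiv i (pderiv j U) y
      - ∑ p, pderiv p U y * ∑ k, ∑ j, (G y)⁻¹ k j * christoffel G p j k y := by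
  simp only [coordLaplacian, mul_sub, Finset.sum_sub_distrib, Finset.mul_sum]
  congr 1
  rw [Finset.sum_comm_cycle]
  refine Finset.sum_congr rfl fun p _ => Finset.sum_congr rfl fun k _ =>
    Finset.sum_congr rfl fun j _ => ?_
  rw [hG.christoffel_symm]; ring

namespace IsMetricAt

/-- The conformal change of the scalar curvature,
`R(e^(2φ) g) = e^(-2φ) (R - 2 (n - 1) Δφ - (n - 1) (n - 2) |dφ|²)`. -/
theorem coordScalar_exp_smul (hG : IsMetricAt G y) (hφ : ContDiffAt ℝ 2 φ y) :
    coordScalar (fun z => Real.exp (2 * φ z) • G z) y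
      = Real.exp (-(2 * φ y)) * (coordScalar G y - 2 * (n - 1) * coordLaplacian G φ y
        - (n - 1) * (n - 2) * ∑ i, pderiv i φ y * coordGradient G φ i y) := by
  set D : Fin n → Fin n → Fin n → EuclideanSpace ℝ (Fin n) → ℝ := fun k i j z =>
    conformalDiff (G z) (fun l => pderiv l φ z) (fun l => coordGradient G φ l z) k i j with hD
  have hΓ : ∀ᶠ z in 𝓝 y, ∀ k i j, christoffel (fun z => Real.exp (2 * φ z) • G z) k i j z
      = christoffel G k i j z + D k i j z := by
    have h2 : ∀ᶠ z in 𝓝 y, ContDiffAt ℝ 2 φ z := hφ.eventually (by simp)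
    filter_upwards [hG.eventually, h2] with z h1 h2 k i j
    exact h1.christoffel_exp_smul (h2.differentiableAt (by norm_num)) k i j
  have hdφ (a) : DifferentiableAt ℝ (pderiv a φ) y :=
    (contDiffAt_pderiv (m := 1) hφ (by norm_num) a).differentiableAt (by norm_num)
  have hdψ (a) : DifferentiableAt ℝ (coordGradient G φ a) y :=
    (hG.contDiffAt_coordGradient hφ a).differentiableAt (by norm_num)
  have hdG (a b) := (hG.contDiffAt a b).differentiableAt (by norm_num)
  have hite (P : Prop) [Decidable P] (a : Fin n) :
      DifferentiableAt ℝ (fun z => if P then pderiv a φ z else 0) y := by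
    split_ifs
    · exact hdφ a
    · exact differentiableAt_const _
  have pite (P : Prop) [Decidable P] (i a : Fin n) :
      pderiv i (fun z => if P then pderiv a φ z else 0) y
        = if P then pderiv i (pderiv a φ) y else 0 := by
    split_ifs
    · rfl
    · exact pderiv_const _ _
  have hdD (k i j) : DifferentiableAt ℝ (D k i j) y :=
    ((hite _ _).fun_add (hite _ _)).fun_sub ((hdG i j).fun_mul (hdψ k))
  have hdΓ (k i j) : DifferentiableAt ℝ (christoffel G k i j) y :=
    (hG.contDiffAt_christoffel k i j).differentiableAt (by norm_num)
  have pD (a k i j) : pderiv a (D k i j) y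
      = (if k = i then pderiv a (pderiv j φ) y else 0)
        + (if k = j then pderiv a (pderiv i φ) y else 0)
        - (pderiv a (fun z => G z i j) y * coordGradient G φ k y
          + G y i j * pderiv a (coordGradient G φ k) y) := by
    simp only [hD, conformalDiff]
    rw [pderiv_sub ((hite _ _).fun_add (hite _ _)) ((hdG i j).fun_mul (hdψ k)),
      pderiv_add (hite _ _) (hite _ _), pite, pite, pderiv_mul (hdG i j) (hdψ k)]
  -- the trace of `D` is taken before differentiating, so that its derivative needs no product rule
  have trD : ∀ᶠ z in 𝓝 y, ∀ p, ∑ i, D i i p z = n * pderiv p φ z := by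
    filter_upwards [hG.eventually] with z hz p
    simp only [hD]
    rw [sum_conformalDiff_trace (hz.sum_mul_coordGradient φ) p, Fintype.card_fin]
  have s1 (k j : Fin n) :
      ∑ i, pderiv i (christoffel (fun z => Real.exp (2 * φ z) • G z) i j k) y
        = ∑ i, pderiv i (christoffel G i j k) y + (pderiv j (pderiv k φ) y
          + pderiv k (pderiv j φ) y - ∑ i, pderiv i (fun z => G z j k) y * coordGradient G φ i y
          - G y j k * ∑ i, pderiv i (coordGradient G φ i) y) := by
    have hs (i : Fin n) : pderiv i (christoffel (fun z => Real.exp (2 * φ z) • G z) i j k) y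
        = pderiv i (christoffel G i j k) y + pderiv i (D i j k) y := by
      rw [← pderiv_add (hdΓ _ _ _) (hdD _ _ _)]
      exact pderiv_congr (hΓ.mono fun z hz => hz i j k) i
    simp only [hs, Finset.sum_add_distrib, pD, Finset.sum_sub_distrib, ← Finset.mul_sum]
    simp
    ring
  have s2 (k j : Fin n) :
      ∑ i, pderiv j (christoffel (fun z => Real.exp (2 * φ z) • G z) i i k) y
        = ∑ i, pderiv j (christoffel G i i k) y + n * pderiv j (pderiv k φ) y := by
    have hs (i : Fin n) : pderiv j (christoffel (fun z => Real.exp (2 * φ z) • G z) i i k) y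
        = pderiv j (christoffel G i i k) y + pderiv j (D i i k) y := by
      rw [← pderiv_add (hdΓ _ _ _) (hdD _ _ _)]
      exact pderiv_congr (hΓ.mono fun z hz => hz i i k) j
    simp only [hs, Finset.sum_add_distrib]
    rw [← pderiv_sum _ fun i _ => hdD i i k, pderiv_congr (trD.mono fun z hz => hz k),
      pderiv_const_mul (hdφ k)]
  have hgh' : ∑ k, ∑ j, (G y)⁻¹ k j * G y j k = n := by simp [hG.sum_inv_mul]
  have hess : ∑ k, ∑ j, (G y)⁻¹ k j * pderiv j (pderiv k φ) y
      = ∑ k, ∑ j, (G y)⁻¹ k j * pderiv k (pderiv j φ) y := by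
    rw [Finset.sum_comm]
    refine Finset.sum_congr rfl fun i _ => Finset.sum_congr rfl fun l _ => ?_
    rw [hG.inv_symm]
  have dG : ∑ k, ∑ j, (G y)⁻¹ k j * ∑ i, pderiv i (fun z => G z j k) y * coordGradient G φ i y
      = 2 * ∑ p, (∑ i, christoffel G i i p y) * coordGradient G φ p y := by
    simp only [hG.sum_christoffel_trace, Finset.mul_sum, Finset.sum_mul]
    rw [Finset.sum_comm_cycle]
    refine Finset.sum_congr rfl fun p _ => Finset.sum_congr rfl fun k _ =>
      Finset.sum_congr rfl fun j _ => ?_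
    rw [hG.pderiv_symm p k j]; ring
  have lin : ∑ k, ∑ j, (G y)⁻¹ k j *
      ((∑ i, pderiv i (christoffel (fun z => Real.exp (2 * φ z) • G z) i j k) y)
        - ∑ i, pderiv j (christoffel (fun z => Real.exp (2 * φ z) • G z) i i k) y)
      = ∑ k, ∑ j, (G y)⁻¹ k j *
        ((∑ i, pderiv i (christoffel G i j k) y) - ∑ i, pderiv j (christoffel G i i k) y)
        + (2 - n) * ∑ k, ∑ j, (G y)⁻¹ k j * pderiv k (pderiv j φ) y
        - 2 * ∑ p, (∑ i, christoffel G i i p y) * coordGradient G φ p y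
        - n * ∑ i, pderiv i (coordGradient G φ i) y := by
    have e (k j : Fin n) : (G y)⁻¹ k j *
      ((∑ i, pderiv i (christoffel (fun z => Real.exp (2 * φ z) • G z) i j k) y)
        - ∑ i, pderiv j (christoffel (fun z => Real.exp (2 * φ z) • G z) i i k) y)
      = (G y)⁻¹ k j *
        ((∑ i, pderiv i (christoffel G i j k) y) - ∑ i, pderiv j (christoffel G i i k) y)
        + (1 - n) * ((G y)⁻¹ k j * pderiv j (pderiv k φ) y)
        + (G y)⁻¹ k j * pderiv k (pderiv j φ) y
        - (G y)⁻¹ k j * ∑ i, pderiv i (fun z => G z j k) y * coordGradient G φ i y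
        - (G y)⁻¹ k j * G y j k * ∑ i, pderiv i (coordGradient G φ i) y := by
      rw [s1, s2]; ring
    simp only [e, Finset.sum_add_distrib, Finset.sum_sub_distrib, ← Finset.mul_sum,
      ← Finset.sum_mul, hess, dG, hgh']
    ring
  have hinv (i j : Fin n) := inv_exp_smul (φ := φ) G hG.det_ne_zero i j
  have hquad : quadTrace (fun i j => (G y)⁻¹ i j)
        (fun k i j => christoffel (fun z => Real.exp (2 * φ z) • G z) k i j y)
        (fun k i j => christoffel (fun z => Real.exp (2 * φ z) • G z) k i j y)
      = quadTrace (fun i j => (G y)⁻¹ i j) (fun k i j => christoffel G k i j y)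
          (fun k i j => christoffel G k i j y)
        + (2 - n) * ∑ p, (∑ i, christoffel G i i p y) * coordGradient G φ p y
        + (n - 2) * ∑ p, pderiv p φ y * ∑ k, ∑ j, (G y)⁻¹ k j * christoffel G p j k y
        - (n - 1) * (n - 2) * ∑ i, pderiv i φ y * coordGradient G φ i y := by
    have e : (fun k i j => christoffel (fun z => Real.exp (2 * φ z) • G z) k i j y)
        = fun k i j => christoffel G k i j y + conformalDiff (G y) (fun l => pderiv l φ y)
          (fun l => coordGradient G φ l y) k i j := by
      funext k i j; exact hΓ.self_of_nhds k i j
    have hh := hG.inv_symm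
    have hgh := hG.sum_inv_mul
    have hg := hG.apply_symm
    have hφ' := hG.sum_mul_coordGradient φ
    have hΓs := fun k i j => hG.christoffel_symm k i j
    have hψ : ∀ k, coordGradient G φ k y = ∑ l, (G y)⁻¹ k l * pderiv l φ y := fun k => rfl
    rw [e, quadTrace_add,
      quadTrace_conformalDiff_right (φ := fun l => pderiv l φ y)
        (ψ := fun l => coordGradient G φ l y) hh hgh hg hψ
        (fun k i j => christoffel G k i j y) hΓs,
      quadTrace_conformalDiff_left hh hgh hg hψ hφ' (fun k i j => christoffel G k i j y) hΓs,
      quadTrace_conformalDiff_self hh hgh hg hψ hφ']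
    simp only [Fintype.card_fin]
    ring
  rw [coordScalar_eq, coordScalar_eq G]
  have hqs (X : Fin n → Fin n → Fin n → ℝ) :
      quadTrace (fun i j => (Real.exp (2 * φ y) • G y)⁻¹ i j) X X
        = Real.exp (-(2 * φ y)) * quadTrace (fun i j => (G y)⁻¹ i j) X X := by
    simp only [quadTrace, hinv, Finset.mul_sum, mul_assoc]
  rw [hqs, hquad]
  simp only [hinv, mul_assoc (Real.exp (-(2 * φ y))), ← Finset.mul_sum]
  rw [← mul_add, lin, hG.sum_pderiv_coordGradient hφ, coordLaplacian_eq G φ y hG]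
  ring

/-- The scalar curvature depends only on the germ of the metric. -/
theorem coordScalar_congr {H : EuclideanSpace ℝ (Fin n) → Matrix (Fin n) (Fin n) ℝ}
    (h : G =ᶠ[𝓝 y] H) : coordScalar G y = coordScalar H y := by
  have hΓ (k i j : Fin n) : christoffel G k i j =ᶠ[𝓝 y] christoffel H k i j := by
    filter_upwards [h.eventually_nhds] with z hz
    have e (a b c : Fin n) : pderiv a (fun w => G w b c) z = pderiv a (fun w => H w b c) z :=
      pderiv_congr (hz.mono fun w hw => by simp only [hw]) a
    simp only [christoffel, e, hz.self_of_nhds]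
  have e (a k i j : Fin n) := pderiv_congr (hΓ k i j) a
  have e' (k i j : Fin n) := (hΓ k i j).self_of_nhds
  simp only [coordScalar, ricci, riemann, e, e', h.self_of_nhds]

/-- The conformal change of the scalar curvature for the factor `U^(4/(n-2))`:
`R(U^(4/(n-2)) g) = U^(-4/(n-2)) (R - 4 (n-1)/(n-2) U⁻¹ ΔU)`. -/
theorem coordScalar_rpow_smul (hn : 3 ≤ n) (hG : IsMetricAt G y)
    {U : EuclideanSpace ℝ (Fin n) → ℝ} (hU : ContDiffAt ℝ 2 U y) (hpos : 0 < U y) :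
    coordScalar (fun z => (U z ^ ((4 : ℝ) / ((n : ℝ) - 2))) • G z) y
      = U y ^ (-((4 : ℝ) / ((n : ℝ) - 2))) * (coordScalar G y
        - 4 * (n - 1) / (n - 2) * (coordLaplacian G U y / U y)) := by
  have hn' : (n : ℝ) - 2 ≠ 0 := by
    have : (3 : ℝ) ≤ n := by exact_mod_cast hn
    linarith
  set b : ℝ := 2 / ((n : ℝ) - 2) with hb
  set φ : EuclideanSpace ℝ (Fin n) → ℝ := fun z => b * Real.log (U z) with hφ
  have hev : ∀ᶠ z in 𝓝 y, 0 < U z ∧ ContDiffAt ℝ 2 U z :=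
    (hU.continuousAt.eventually_const_lt hpos).and (hU.eventually (by simp))
  have hφ2 : ContDiffAt ℝ 2 φ y := contDiffAt_const.mul (hU.log hpos.ne')
  have hG' : (fun z => (U z ^ ((4 : ℝ) / ((n : ℝ) - 2))) • G z)
      =ᶠ[𝓝 y] fun z => Real.exp (2 * φ z) • G z := by
    filter_upwards [hev] with z hz
    rw [Real.rpow_def_of_pos hz.1]
    congr 2
    simp only [hφ, hb]
    ring
  have hd (l : Fin n) : pderiv l φ =ᶠ[𝓝 y] fun z => b * ((U z)⁻¹ * pderiv l U z) := by
    filter_upwards [hev] with z hz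
    have hUd := hz.2.differentiableAt (by norm_num)
    rw [hφ, pderiv_const_mul (hUd.log hz.1.ne'), pderiv_comp (Real.hasDerivAt_log hz.1.ne') hUd]
  have hUd := hU.differentiableAt (by norm_num)
  have hUd2 (l) : DifferentiableAt ℝ (pderiv l U) y :=
    (contDiffAt_pderiv (m := 1) hU (by norm_num) l).differentiableAt (by norm_num)
  have hd2 (i l : Fin n) : pderiv i (pderiv l φ) y
      = b * ((U y)⁻¹ * pderiv i (pderiv l U) y
        - (U y)⁻¹ ^ 2 * (pderiv i U y * pderiv l U y)) := by
    rw [pderiv_congr (hd l), pderiv_const_mul ((hUd.fun_inv hpos.ne').fun_mul (hUd2 l)),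
      pderiv_mul (hUd.fun_inv hpos.ne') (hUd2 l), pderiv_comp (hasDerivAt_inv hpos.ne') hUd]
    ring
  have hlap : coordLaplacian G φ y = b * ((U y)⁻¹ * coordLaplacian G U y
      - (U y)⁻¹ ^ 2 * ∑ i, pderiv i U y * coordGradient G U i y) := by
    simp only [coordLaplacian, coordGradient, hd2, fun l => (hd l).self_of_nhds, Finset.mul_sum,
      ← Finset.sum_sub_distrib]
    refine Finset.sum_congr rfl fun i _ => Finset.sum_congr rfl fun j _ => ?_
    have : ∑ k, christoffel G k i j y * (b * ((U y)⁻¹ * pderiv k U y))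
        = b * (U y)⁻¹ * ∑ k, christoffel G k i j y * pderiv k U y := by
      rw [Finset.mul_sum]
      exact Finset.sum_congr rfl fun k _ => by ring
    rw [this]
    ring
  have hgrad : ∑ i, pderiv i φ y * coordGradient G φ i y
      = b ^ 2 * (U y)⁻¹ ^ 2 * ∑ i, pderiv i U y * coordGradient G U i y := by
    simp only [coordGradient, fun l => (hd l).self_of_nhds, Finset.mul_sum]
    exact Finset.sum_congr rfl fun i _ => Finset.sum_congr rfl fun j _ => by ring
  have hexp : Real.exp (-(2 * φ y)) = U y ^ (-((4 : ℝ) / ((n : ℝ) - 2))) := by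
    rw [Real.rpow_def_of_pos hpos]
    congr 1
    simp only [hφ, hb]
    ring
  rw [coordScalar_congr hG', hG.coordScalar_exp_smul hφ2, hexp, hlap, hgrad]
  congr 1
  -- the gradient terms cancel since `(n - 2) b² = 2 b`
  have hb2 : (n - 2) * b = 2 := by rw [hb]; field_simp
  have hb3 : 4 * ((n : ℝ) - 1) / (n - 2) = 2 * (n - 1) * b := by rw [hb]; ring
  rw [hb3]
  linear_combination (-(n - 1) * b * (U y)⁻¹ ^ 2 * ∑ i, pderiv i U y * coordGradient G U i y) * hb2

end IsMetricAt
end ConformalLaw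

/-! ### The Laplacian at a maximum -/

section LaplacianMax

variable {n : ℕ} {G : EuclideanSpace ℝ (Fin n) → Matrix (Fin n) (Fin n) ℝ}
  {U W : EuclideanSpace ℝ (Fin n) → ℝ} {y : EuclideanSpace ℝ (Fin n)}

theorem coordLaplacian_sub_const_mul (hU : ContDiffAt ℝ 2 U y) (hW : ContDiffAt ℝ 2 W y) (m : ℝ) :
    coordLaplacian G (fun z => U z - m * W z) y
      = coordLaplacian G U y - m * coordLaplacian G W y := by
  have h (l : Fin n) : pderiv l (fun z => U z - m * W z)
      =ᶠ[𝓝 y] fun z => pderiv l U z - m * pderiv l W z := by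
    filter_upwards [hU.eventually (by simp), hW.eventually (by simp)] with z h1 h2
    have h1 := h1.differentiableAt (by norm_num)
    have h2 := h2.differentiableAt (by norm_num)
    rw [pderiv_sub h1 (h2.const_mul m), pderiv_const_mul h2]
  have hU2 (l) : DifferentiableAt ℝ (pderiv l U) y :=
    (contDiffAt_pderiv (m := 1) hU (by norm_num) l).differentiableAt (by norm_num)
  have hW2 (l) : DifferentiableAt ℝ (pderiv l W) y :=
    (contDiffAt_pderiv (m := 1) hW (by norm_num) l).differentiableAt (by norm_num)
  have h2 (i l : Fin n) : pderiv i (pderiv l (fun z => U z - m * W z)) y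
      = pderiv i (pderiv l U) y - m * pderiv i (pderiv l W) y := by
    rw [pderiv_congr (h l), pderiv_sub (hU2 l) ((hW2 l).const_mul m), pderiv_const_mul (hW2 l)]
  simp only [coordLaplacian, h2, fun l => (h l).self_of_nhds, Finset.mul_sum,
    ← Finset.sum_sub_distrib]
  refine Finset.sum_congr rfl fun i _ => Finset.sum_congr rfl fun j _ => ?_
  simp only [mul_sub, Finset.sum_sub_distrib, Finset.mul_sum]
  have : ∀ k, m * ((G y)⁻¹ i j * (christoffel G k i j y * pderiv k W y))
    = (G y)⁻¹ i j * (christoffel G k i j y * (m * pderiv k W y)) := fun k => by ring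
  simp only [this]
  ring

theorem deriv_deriv_nonpos_of_isLocalMax {f : ℝ → ℝ} {a : ℝ} (h : IsLocalMax f a)
    (hc : ContinuousAt f a) : deriv (deriv f) a ≤ 0 := by
  by_contra! hpos
  have hmin := isLocalMin_of_deriv_deriv_pos hpos h.deriv_eq_zero hc
  -- `f` is then locally constant
  have hconst : f =ᶠ[𝓝 a] fun _ => f a := by
    filter_upwards [h, hmin] with z h1 h2 using le_antisymm h1 h2
  have : deriv f =ᶠ[𝓝 a] fun _ => 0 := by
    simpa using hconst.deriv
  rw [this.deriv_eq] at hpos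
  simp at hpos

/-- The Hessian of a function at a local maximum is negative semidefinite. -/
theorem fderiv_fderiv_nonpos_of_isLocalMax (hU : ContDiffAt ℝ 2 U y) (h : IsLocalMax U y)
    (V : EuclideanSpace ℝ (Fin n)) : fderiv ℝ (fderiv ℝ U) y V V ≤ 0 := by
  have hd2 : DifferentiableAt ℝ (fderiv ℝ U) y :=
    (hU.fderiv_right (m := 1) (by norm_num)).differentiableAt (by norm_num)
  have hline (t : ℝ) : HasDerivAt (fun t : ℝ => y + t • V) V t := by
    simpa using ((hasDerivAt_id t).smul_const V).const_add y
  have hcont : Tendsto (fun t : ℝ => y + t • V) (𝓝 0) (𝓝 y) := by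
    simpa using (hline 0).continuousAt.tendsto
  have hd1 : deriv (fun t : ℝ => U (y + t • V)) =ᶠ[𝓝 0] fun t => fderiv ℝ U (y + t • V) V := by
    have : ∀ᶠ z in 𝓝 y, ContDiffAt ℝ 2 U z := hU.eventually (by simp)
    filter_upwards [hcont.eventually this] with t ht
    exact ((ht.differentiableAt (by norm_num)).hasFDerivAt.comp_hasDerivAt t (hline t)).deriv
  have hF : HasFDerivAt (fun z => fderiv ℝ U z V) ((fderiv ℝ (fderiv ℝ U) y).flip V) y := by
    simpa using hd2.hasFDerivAt.clm_apply (hasFDerivAt_const V y)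
  have hd2' : HasDerivAt (fun t : ℝ => fderiv ℝ U (y + t • V) V)
      (fderiv ℝ (fderiv ℝ U) y V V) 0 :=
    HasFDerivAt.comp_hasDerivAt_of_eq (0 : ℝ) hF (hline 0) (by simp)
  have hmax : IsLocalMax (fun t : ℝ => U (y + t • V)) 0 := by
    filter_upwards [hcont.eventually h] with t ht
    simpa using ht
  have hc : ContinuousAt (fun t : ℝ => U (y + t • V)) 0 :=
    ContinuousAt.comp_of_eq hU.continuousAt (hline 0).continuousAt (by simp)
  rw [← hd2'.deriv, ← hd1.deriv_eq]
  exact deriv_deriv_nonpos_of_isLocalMax hmax hc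

theorem sum_pderiv_pderiv_nonpos_of_isLocalMax (hU : ContDiffAt ℝ 2 U y) (h : IsLocalMax U y)
    (v : Fin n → ℝ) : ∑ i, ∑ j, v i * v j * pderiv i (pderiv j U) y ≤ 0 := by
  have hd2 : DifferentiableAt ℝ (fderiv ℝ U) y :=
    (hU.fderiv_right (m := 1) (by norm_num)).differentiableAt (by norm_num)
  have hp (i j : Fin n) : pderiv i (pderiv j U) y
      = fderiv ℝ (fderiv ℝ U) y (EuclideanSpace.single i 1) (EuclideanSpace.single j 1) := by
    have : pderiv j U = fun z => fderiv ℝ U z (EuclideanSpace.single j 1) := rfl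
    rw [pderiv, this, fderiv_clm_apply hd2 (differentiableAt_const _)]
    simp
  refine le_of_eq_of_le ?_ (fderiv_fderiv_nonpos_of_isLocalMax hU h
    (∑ i, v i • EuclideanSpace.single i 1))
  simp only [map_sum, map_smul, _root_.sum_apply, _root_.smul_apply, smul_eq_mul, hp,
    Finset.mul_sum]
  rw [Finset.sum_comm]
  exact Finset.sum_congr rfl fun i _ => Finset.sum_congr rfl fun j _ => by ring

open scoped MatrixOrder ComplexOrder in
theorem coordLaplacian_nonpos_of_isLocalMax (hG : (G y).PosDef) (hU : ContDiffAt ℝ 2 U y)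
    (h : IsLocalMax U y) : coordLaplacian G U y ≤ 0 := by
  have hgrad (l : Fin n) : pderiv l U y = 0 := by
    simp [pderiv, h.fderiv_eq_zero]
  -- with `G⁻¹ = Bᵀ B`, the Laplacian is the sum of the Hessian over the rows of `B`
  obtain ⟨B, hB⟩ := CStarAlgebra.nonneg_iff_eq_star_mul_self.mp hG.inv.posSemidef.nonneg
  have : coordLaplacian G U y
      = ∑ a, ∑ i, ∑ j, B a i * B a j * pderiv i (pderiv j U) y := by
    simp only [coordLaplacian, hgrad, hB, Matrix.mul_apply, Finset.sum_mul]
    rw [Finset.sum_comm_cycle]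
    refine Finset.sum_congr rfl fun a _ => Finset.sum_congr rfl fun i _ =>
      Finset.sum_congr rfl fun j _ => ?_
    simp [Matrix.star_apply]
  rw [this]
  exact Finset.sum_nonpos fun a _ => sum_pderiv_pderiv_nonpos_of_isLocalMax hU h (B a)

end LaplacianMax

/-! ### Metrics in charts -/

section MetricMatrix

variable {n : ℕ} {M : Type*} [TopologicalSpace M] [ChartedSpace (EuclideanSpace ℝ (Fin n)) M]

theorem metricMatrix_conformal (g : BilinField n M) (w : M → ℝ) (x : M)
    (y : EuclideanSpace ℝ (Fin n)) :
    metricMatrix (conformal g w) x y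
      = (w ((extChartAt (𝓡 n) x).symm y) ^ ((4 : ℝ) / ((n : ℝ) - 2))) • metricMatrix g x y := by
  ext i j
  rfl

variable [IsManifold (𝓡 n) ∞ M]

/-- The coordinate fields of the chart around `x` are those of the trivialization of the tangent
bundle at `x`. -/
theorem coordVec_eq (x : M) (i : Fin n) {y : EuclideanSpace ℝ (Fin n)}
    (hy : y ∈ (extChartAt (𝓡 n) x).target) :
    coordVec x i y = (trivializationAt (EuclideanSpace ℝ (Fin n)) (TangentSpace (𝓡 n)) x).symmL ℝ
      ((extChartAt (𝓡 n) x).symm y) (EuclideanSpace.single i 1) := by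
  have hp : (extChartAt (𝓡 n) x).symm y ∈ (chartAt (EuclideanSpace ℝ (Fin n)) x).source := by
    rw [← extChartAt_source (I := 𝓡 n)]
    exact (extChartAt (𝓡 n) x).map_target hy
  have : IsManifold (𝓡 n) 1 M := .of_le (n := ∞) (by simp)
  rw [TangentBundle.symmL_trivializationAt hp, (extChartAt (𝓡 n) x).right_inv hy]
  rfl

theorem contMDiffOn_symmL (x : M) (v : EuclideanSpace ℝ (Fin n)) :
    ContMDiffOn (𝓡 n) ((𝓡 n).prod 𝓘(ℝ, EuclideanSpace ℝ (Fin n))) ∞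
      (fun p => Bundle.TotalSpace.mk' (EuclideanSpace ℝ (Fin n)) p
        ((trivializationAt (EuclideanSpace ℝ (Fin n)) (TangentSpace (𝓡 n)) x).symmL ℝ p v))
      (chartAt (EuclideanSpace ℝ (Fin n)) x).source := by
  set e := trivializationAt (EuclideanSpace ℝ (Fin n)) (TangentSpace (𝓡 n) : M → Type _) x
  have hb : e.baseSet = (chartAt (EuclideanSpace ℝ (Fin n)) x).source := rfl
  rw [← hb, e.contMDiffOn_section_baseSet_iff]
  refine (contMDiffOn_const (c := v)).congr fun p hp => ?_
  rw [Bundle.Trivialization.symmL_apply e hp]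
  exact congrArg Prod.snd (e.apply_mk_symm hp v)

variable (g₀ : Bundle.ContMDiffRiemannianMetric (𝓡 n) ∞ (EuclideanSpace ℝ (Fin n))
      (fun p : M => TangentSpace (𝓡 n) p))

theorem contDiffOn_metricMatrix (x : M) (i j : Fin n) :
    ContDiffOn ℝ ∞ (fun y => metricMatrix g₀.inner x y i j) (extChartAt (𝓡 n) x).target := by
  have h1 : ContMDiffOn (𝓡 n) 𝓘(ℝ, ℝ) ∞ (fun p => g₀.inner p
      ((trivializationAt (EuclideanSpace ℝ (Fin n)) (TangentSpace (𝓡 n)) x).symmL ℝ p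
        (EuclideanSpace.single i 1))
      ((trivializationAt (EuclideanSpace ℝ (Fin n)) (TangentSpace (𝓡 n)) x).symmL ℝ p
        (EuclideanSpace.single j 1))) (chartAt (EuclideanSpace ℝ (Fin n)) x).source := by
    intro p hp
    have : ContMDiffWithinAt (𝓡 n) ((𝓡 n).prod 𝓘(ℝ, ℝ)) ∞ (fun p =>
        Bundle.TotalSpace.mk' ℝ (E := Bundle.Trivial M ℝ) p (g₀.inner p
      ((trivializationAt (EuclideanSpace ℝ (Fin n)) (TangentSpace (𝓡 n)) x).symmL ℝ p
        (EuclideanSpace.single i 1))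
      ((trivializationAt (EuclideanSpace ℝ (Fin n)) (TangentSpace (𝓡 n)) x).symmL ℝ p
        (EuclideanSpace.single j 1)))) (chartAt (EuclideanSpace ℝ (Fin n)) x).source p := by
      apply ContMDiffWithinAt.clm_bundle_apply₂ (F₁ := EuclideanSpace ℝ (Fin n))
        (F₂ := EuclideanSpace ℝ (Fin n))
      · exact g₀.contMDiff.contMDiffAt.contMDiffWithinAt
      · exact contMDiffOn_symmL x _ p hp
      · exact contMDiffOn_symmL x _ p hp
    simp only [Bundle.contMDiffWithinAt_totalSpace] at this
    exact this.2
  have h2 := h1.comp (contMDiffOn_extChartAt_symm (I := 𝓡 n) (n := ∞) x) (fun y hy => by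
    have := (extChartAt (𝓡 n) x).map_target hy
    rwa [extChartAt_source] at this)
  rw [contMDiffOn_iff_contDiffOn] at h2
  refine h2.congr fun y hy => ?_
  simp only [metricMatrix, Matrix.of_apply, coordVec_eq x _ hy]
  rfl

theorem posDef_metricMatrix (x : M) {y : EuclideanSpace ℝ (Fin n)}
    (hy : y ∈ (extChartAt (𝓡 n) x).target) : (metricMatrix g₀.inner x y).PosDef := by
  refine Matrix.PosDef.of_dotProduct_mulVec_pos ?_ fun v hv => ?_
  · ext i j
    exact g₀.symm _ _ _
  set p := (extChartAt (𝓡 n) x).symm y with hp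
  set e := trivializationAt (EuclideanSpace ℝ (Fin n)) (TangentSpace (𝓡 n) : M → Type _) x
  have hb : p ∈ e.baseSet := by
    have := (extChartAt (𝓡 n) x).map_target hy
    rwa [extChartAt_source] at this
  set w : EuclideanSpace ℝ (Fin n) := ∑ i, v i • EuclideanSpace.single i 1 with hw
  have hsum : star v ⬝ᵥ (metricMatrix g₀.inner x y).mulVec v
      = g₀.inner p (e.symmL ℝ p w) (e.symmL ℝ p w) := by
    have hG (i j : Fin n) : metricMatrix g₀.inner x y i j
        = g₀.inner p (e.symmL ℝ p (EuclideanSpace.single i 1))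
          (e.symmL ℝ p (EuclideanSpace.single j 1)) := by
      simp only [metricMatrix, Matrix.of_apply, coordVec_eq x _ hy]
      rfl
    simp only [hw, map_sum, map_smul, _root_.sum_apply, _root_.smul_apply, smul_eq_mul,
      dotProduct, Matrix.mulVec, Finset.mul_sum, hG]
    rw [Finset.sum_comm]
    refine Finset.sum_congr rfl fun i _ => Finset.sum_congr rfl fun j _ => ?_
    simp only [Pi.star_apply, star_trivial]
    ring
  rw [hsum]
  refine g₀.pos _ _ fun h0 => hv ?_
  have hw0 : w = 0 := by
    rw [← Bundle.Trivialization.continuousLinearMapAt_symmL (R := ℝ) e hb w, h0, map_zero]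
  funext i
  have : w i = v i := by simp [hw, Pi.single_apply]
  rw [← this, hw0]; rfl

theorem isMetricAt_metricMatrix (x : M) {y : EuclideanSpace ℝ (Fin n)}
    (hy : y ∈ (extChartAt (𝓡 n) x).target) : IsMetricAt (metricMatrix g₀.inner x) y where
  contDiffAt i j := ((contDiffOn_metricMatrix g₀ x i j).contDiffAt
    ((isOpen_extChartAt_target x).mem_nhds hy)).of_le ENat.LEInfty.out
  symm := by
    filter_upwards [(isOpen_extChartAt_target x).mem_nhds hy] with z hz
    simpa using (posDef_metricMatrix g₀ x hz).isHermitian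
  det_ne_zero := (posDef_metricMatrix g₀ x hy).det_pos.ne'

theorem contDiffAt_comp_extChartAt_symm {w : M → ℝ} (hw : ContMDiff (𝓡 n) 𝓘(ℝ, ℝ) 2 w) (p : M) :
    ContDiffAt ℝ 2 (w ∘ (extChartAt (𝓡 n) p).symm) (extChartAt (𝓡 n) p p) := by
  have := (hw.contMDiffOn (s := Set.univ)).comp
    ((contMDiffOn_extChartAt_symm (I := 𝓡 n) (n := ∞) p).of_le (m := 2) ENat.LEInfty.out)
    (fun y _ => Set.mem_univ _)
  rw [contMDiffOn_iff_contDiffOn] at this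
  exact this.contDiffAt (extChartAt_target_mem_nhds p)

theorem scalarCurvature_conformal (hn : 3 ≤ n) {w : M → ℝ}
    (hw : ContMDiff (𝓡 n) 𝓘(ℝ, ℝ) 2 w) (hpos : ∀ p, 0 < w p) (p : M) :
    scalarCurvature (conformal g₀.inner w) p
      = w p ^ (-((4 : ℝ) / ((n : ℝ) - 2))) * (scalarCurvature g₀.inner p
        - 4 * (n - 1) / (n - 2) * (laplacian g₀.inner w p / w p)) := by
  have h := (isMetricAt_metricMatrix g₀ p (mem_extChartAt_target p)).coordScalar_rpow_smul hn
    (contDiffAt_comp_extChartAt_symm hw p) (by simpa using hpos p)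
  simp only [Function.comp_apply, extChartAt_to_inv] at h
  exact h

/-- The weak maximum principle: at a maximum of `w - m v` one has `Δw ≤ m Δv`. -/
theorem laplacian_le_of_isMax {w v : M → ℝ} (hw : ContMDiff (𝓡 n) 𝓘(ℝ, ℝ) 2 w)
    (hv : ContMDiff (𝓡 n) 𝓘(ℝ, ℝ) 2 v) (m : ℝ) (p : M)
    (hmax : ∀ q, w q - m * v q ≤ w p - m * v p) :
    laplacian g₀.inner w p ≤ m * laplacian g₀.inner v p := by
  have h1 := contDiffAt_comp_extChartAt_symm hw p
  have h2 := contDiffAt_comp_extChartAt_symm hv p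
  have h3 := coordLaplacian_nonpos_of_isLocalMax
    (posDef_metricMatrix g₀ p (mem_extChartAt_target p))
    (h1.sub (contDiffAt_const.mul h2)) (U := fun z => (w ∘ (extChartAt (𝓡 n) p).symm) z
      - m * (v ∘ (extChartAt (𝓡 n) p).symm) z) (Eventually.of_forall fun z => by
        simpa using hmax _)
  rw [coordLaplacian_sub_const_mul h1 h2] at h3
  exact sub_nonpos.1 h3

end MetricMatrix

/-! ### The Riemannian volume of a conformal metric -/

section Volume

variable {n : ℕ} {M : Type*} [TopologicalSpace M] [ChartedSpace (EuclideanSpace ℝ (Fin n)) M]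
  [IsManifold (𝓡 n) ∞ M]
  (g₀ : Bundle.ContMDiffRiemannianMetric (𝓡 n) ∞ (EuclideanSpace ℝ (Fin n))
    (fun p : M => TangentSpace (𝓡 n) p))

theorem continuousOn_det_metricMatrix (x : M) :
    ContinuousOn (fun y => (metricMatrix g₀.inner x y).det) (extChartAt (𝓡 n) x).target := by
  have h (i j : Fin n) := (contDiffOn_metricMatrix g₀ x i j).continuousOn
  have : ContinuousOn (metricMatrix g₀.inner x) (extChartAt (𝓡 n) x).target :=
    continuousOn_pi.2 fun i => continuousOn_pi.2 fun j => h i j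
  exact (Continuous.matrix_det continuous_id).comp_continuousOn this

variable [T2Space M] [CompactSpace M] [MeasurableSpace M] [BorelSpace M]

/-- The integral against the Riemannian volume, written in the charts. -/
theorem lintegral_riemVolume {g : BilinField n M}
    (hg : ∀ x : M, ContinuousOn (fun y => (metricMatrix g x y).det) (extChartAt (𝓡 n) x).target)
    {F : M → ENNReal} (hF : Measurable F) :
    ∫⁻ p, F p ∂(riemVolume g) = ∑' x : M, ∫⁻ y in (extChartAt (𝓡 n) x).target,
      ENNReal.ofReal (Real.sqrt (metricMatrix g x y).det) *
        (ENNReal.ofReal (chartPartition n M x ((extChartAt (𝓡 n) x).symm y)) *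
          F ((extChartAt (𝓡 n) x).symm y)) := by
  rw [riemVolume, lintegral_sum_measure]
  refine tsum_congr fun x => ?_
  have ht : MeasurableSet (extChartAt (𝓡 n) x).target := (isOpen_extChartAt_target x).measurableSet
  have hρ : Measurable fun p => ENNReal.ofReal (chartPartition n M x p) :=
    (chartPartition n M x).contMDiff.continuous.measurable.ennreal_ofReal
  have hsymm : AEMeasurable (extChartAt (𝓡 n) x).symm
      (volume.restrict (extChartAt (𝓡 n) x).target) :=
    (continuousOn_extChartAt_symm x).aemeasurable ht
  have hd : AEMeasurable (fun y => ENNReal.ofReal (Real.sqrt (metricMatrix g x y).det))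
      (volume.restrict (extChartAt (𝓡 n) x).target) :=
    ((hg x).sqrt.aemeasurable ht).ennreal_ofReal
  have hρF : Measurable ((fun p => ENNReal.ofReal (chartPartition n M x p)) * F) := hρ.mul hF
  rw [lintegral_withDensity_eq_lintegral_mul _ hρ hF, chartVolume,
    lintegral_map' hρF.aemeasurable (hsymm.mono_ac (withDensity_absolutelyContinuous _ _))]
  exact lintegral_withDensity_eq_lintegral_mul₀ hd (hρF.comp_aemeasurable hsymm)


theorem riemVolume_conformal (hn : 3 ≤ n) {w : M → ℝ} (hw : Continuous w) (hpos : ∀ p, 0 < w p) :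
    riemVolume (conformal g₀.inner w) = (riemVolume g₀.inner).withDensity
      fun p => ENNReal.ofReal (w p ^ (2 * (n : ℝ) / ((n : ℝ) - 2))) := by
  have hn' : (n : ℝ) - 2 ≠ 0 := by
    have : (3 : ℝ) ≤ n := by exact_mod_cast hn
    linarith
  have hg := continuousOn_det_metricMatrix g₀
  have hwp (r : ℝ) : Continuous fun p => w p ^ r :=
    hw.rpow_const fun p => Or.inl (hpos p).ne'
  have hg' (x : M) : ContinuousOn (fun y => (metricMatrix (conformal g₀.inner w) x y).det)
      (extChartAt (𝓡 n) x).target := by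
    simp only [metricMatrix_conformal, Matrix.det_smul]
    exact (((hwp _).comp_continuousOn (continuousOn_extChartAt_symm x)).pow _).mul (hg x)
  have hm : Measurable fun p => ENNReal.ofReal (w p ^ (2 * (n : ℝ) / ((n : ℝ) - 2))) :=
    (hwp _).measurable.ennreal_ofReal
  refine Measure.ext_of_lintegral _ fun F hF => ?_
  rw [lintegral_withDensity_eq_lintegral_mul _ hm hF, lintegral_riemVolume hg' hF,
    lintegral_riemVolume hg (hm.mul hF)]
  refine tsum_congr fun x => lintegral_congr fun y => ?_
  set p := (extChartAt (𝓡 n) x).symm y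
  have hd : Real.sqrt (metricMatrix (conformal g₀.inner w) x y).det
      = w p ^ (2 * (n : ℝ) / ((n : ℝ) - 2)) * Real.sqrt (metricMatrix g₀.inner x y).det := by
    rw [metricMatrix_conformal, Matrix.det_smul, Fintype.card_fin,
      Real.sqrt_mul (pow_nonneg (Real.rpow_nonneg (hpos p).le _) _)]
    congr 1
    rw [← Real.rpow_natCast, ← Real.rpow_mul (hpos p).le, Real.sqrt_eq_rpow,
      ← Real.rpow_mul (hpos p).le]
    congr 1
    field_simp
    norm_num
  rw [hd, ENNReal.ofReal_mul (Real.rpow_nonneg (hpos p).le _)]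
  simp only [Pi.mul_apply]
  ring

/-- The volume is finite: only finitely many functions of the partition of unity do not vanish, and
each has compact support in the domain of its chart. -/
theorem isFiniteMeasure_riemVolume : IsFiniteMeasure (riemVolume g₀.inner) := by
  constructor
  have hg := continuousOn_det_metricMatrix g₀
  rw [← lintegral_one, lintegral_riemVolume hg measurable_const]
  have hfin : {x : M | (Function.support (chartPartition n M x)).Nonempty}.Finite :=
    (chartPartition n M).locallyFinite.finite_nonempty_of_compact
  rw [tsum_eq_sum (s := hfin.toFinset)]
  · refine ENNReal.sum_lt_top.2 fun x _ => ?_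
    set K := extChartAt (𝓡 n) x '' tsupport (chartPartition n M x) with hK
    have hsub : tsupport (chartPartition n M x) ⊆ (extChartAt (𝓡 n) x).source := by
      rw [extChartAt_source]
      exact chartPartition_isSubordinate n M x
    have hKc : IsCompact K :=
      (isClosed_tsupport _).isCompact.image_of_continuousOn
        ((continuousOn_extChartAt x).mono hsub)
    have hKt : K ⊆ (extChartAt (𝓡 n) x).target := by
      rintro _ ⟨p, hp, rfl⟩
      exact (extChartAt (𝓡 n) x).map_source (hsub hp)
    have hint : IntegrableOn (fun y => Real.sqrt (metricMatrix g₀.inner x y).det) K :=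
      ((hg x).sqrt.mono hKt).integrableOn_compact hKc
    refine lt_of_le_of_lt ?_ hint.lintegral_lt_top
    rw [← lintegral_indicator (isOpen_extChartAt_target x).measurableSet,
      ← lintegral_indicator hKc.measurableSet]
    refine lintegral_mono fun y => ?_
    by_cases hy : y ∈ (extChartAt (𝓡 n) x).target
    · rw [Set.indicator_of_mem hy]
      by_cases hyK : y ∈ K
      · rw [Set.indicator_of_mem hyK, mul_one]
        refine mul_le_of_le_one_right (zero_le) ?_
        rw [ENNReal.ofReal_le_one]
        exact (chartPartition n M).le_one _ _
      · have : chartPartition n M x ((extChartAt (𝓡 n) x).symm y) = 0 := by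
          by_contra h
          exact hyK ⟨_, subset_tsupport _ h, (extChartAt (𝓡 n) x).right_inv hy⟩
        rw [this]
        simp
    · rw [Set.indicator_of_notMem hy]
      exact zero_le
  · intro x hx
    have hx' : ∀ p, chartPartition n M x p = 0 := by
      simpa [Set.not_nonempty_iff_eq_empty, Function.support_eq_empty_iff, funext_iff] using hx
    simp [hx']

theorem riemVolume_ne_zero [Nonempty M] : riemVolume g₀.inner ≠ 0 := by
  intro h0
  have hg := continuousOn_det_metricMatrix g₀
  obtain ⟨p⟩ := ‹Nonempty M›
  obtain ⟨x, hx⟩ : ∃ x, 0 < chartPartition n M x p :=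
    (chartPartition n M).exists_pos_of_mem (Set.mem_univ p)
  have h1 : ∫⁻ _, 1 ∂(riemVolume g₀.inner) = 0 := by simp [h0]
  rw [lintegral_riemVolume hg measurable_const, ENNReal.tsum_eq_zero] at h1
  have ho := isOpen_extChartAt_target (I := 𝓡 n) x
  have hρ := (chartPartition n M x).contMDiff.continuous
  have hρs : ContinuousOn (fun y => chartPartition n M x ((extChartAt (𝓡 n) x).symm y))
      (extChartAt (𝓡 n) x).target := hρ.comp_continuousOn (continuousOn_extChartAt_symm x)
  have hm : AEMeasurable (fun y => ENNReal.ofReal (Real.sqrt (metricMatrix g₀.inner x y).det) *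
      (ENNReal.ofReal (chartPartition n M x ((extChartAt (𝓡 n) x).symm y)) * 1))
      (volume.restrict (extChartAt (𝓡 n) x).target) :=
    ((hg x).sqrt.aemeasurable ho.measurableSet).ennreal_ofReal.mul
      ((hρs.aemeasurable ho.measurableSet).ennreal_ofReal.mul aemeasurable_const)
  have h2 := (lintegral_eq_zero_iff' hm).1 (h1 x)
  rw [Filter.EventuallyEq, ae_restrict_iff' ho.measurableSet] at h2
  -- the integrand is positive on a non-empty open set
  have hV := hρs.isOpen_inter_preimage ho (isOpen_Ioi (a := 0))
  have hps : p ∈ (extChartAt (𝓡 n) x).source := by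
    rw [extChartAt_source]
    exact chartPartition_isSubordinate n M x (subset_tsupport _ hx.ne')
  refine (hV.measure_pos volume ⟨extChartAt (𝓡 n) x p, (extChartAt (𝓡 n) x).map_source hps, ?_⟩).ne'
    (measure_mono_null ?_ h2)
  · change 0 < chartPartition n M x ((extChartAt (𝓡 n) x).symm (extChartAt (𝓡 n) x p))
    rwa [(extChartAt (𝓡 n) x).left_inv hps]
  · rintro y ⟨hy, hy'⟩ hc
    have hc := hc hy
    have hdet := (posDef_metricMatrix g₀ x hy).det_pos
    have hy' : 0 < chartPartition n M x ((extChartAt (𝓡 n) x).symm y) := hy'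
    simp only [Pi.zero_apply, mul_one, mul_eq_zero, ENNReal.ofReal_eq_zero, not_le.2 hy',
      not_le.2 (Real.sqrt_pos.2 hdet), or_self] at hc

end Volume

/-! ### Maximum principles in time -/

section ParabolicMaximumPrinciple

open Set

theorem deriv_nonneg_of_forall_le_right {φ : ℝ → ℝ} {φ' a b s t : ℝ} (hs : a ≤ s) (hst : s < t)
    (htb : t ≤ b) (hd : HasDerivWithinAt φ φ' (Icc a b) t) (h : ∀ τ ∈ Ico s t, φ τ ≤ φ t) :
    0 ≤ φ' := by
  have h1 : HasDerivWithinAt φ φ' (Iio t) t := by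
    have : HasDerivWithinAt φ φ' (Ico s t) t :=
      hd.mono fun τ hτ => ⟨hs.trans hτ.1, hτ.2.le.trans htb⟩
    exact this.mono_of_mem_nhdsWithin (Ico_mem_nhdsLT hst)
  rw [hasDerivWithinAt_iff_tendsto_slope' (by simp)] at h1
  refine ge_of_tendsto h1 ?_
  filter_upwards [Ico_mem_nhdsLT hst] with τ hτ
  rw [slope_def_field]
  exact div_nonneg_of_nonpos (sub_nonpos.2 (h τ hτ)) (sub_nonpos.2 hτ.2.le)

theorem deriv_nonpos_of_forall_ge_right {φ : ℝ → ℝ} {φ' a b s t : ℝ} (hs : a ≤ s) (hst : s < t)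
    (htb : t ≤ b) (hd : HasDerivWithinAt φ φ' (Icc a b) t) (h : ∀ τ ∈ Ico s t, φ t ≤ φ τ) :
    φ' ≤ 0 := by
  have := deriv_nonneg_of_forall_le_right hs hst htb hd.neg fun τ hτ => neg_le_neg (h τ hτ)
  linarith

theorem deriv_nonneg_of_forall_ge_left {φ : ℝ → ℝ} {φ' a b s t : ℝ} (hs : a ≤ s) (hst : s < t)
    (htb : t ≤ b) (hd : HasDerivWithinAt φ φ' (Icc a b) s) (h : ∀ τ ∈ Ioc s t, φ s ≤ φ τ) :
    0 ≤ φ' := by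
  have h1 : HasDerivWithinAt φ φ' (Ioi s) s := by
    have : HasDerivWithinAt φ φ' (Ioc s t) s :=
      hd.mono fun τ hτ => ⟨hs.trans hτ.1.le, hτ.2.trans htb⟩
    exact this.mono_of_mem_nhdsWithin (Ioc_mem_nhdsGT hst)
  rw [hasDerivWithinAt_iff_tendsto_slope' (by simp)] at h1
  refine ge_of_tendsto h1 ?_
  filter_upwards [Ioc_mem_nhdsGT hst] with τ hτ
  rw [slope_def_field]
  exact div_nonneg (sub_nonneg.2 (h τ hτ)) (sub_nonneg.2 hτ.1.le)

theorem sub_nonneg_of_deriv_nonneg {φ φ' : ℝ → ℝ} {a b : ℝ}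
    (hd : ∀ t ∈ Icc a b, HasDerivWithinAt φ (φ' t) (Icc a b) t) (h : ∀ t ∈ Icc a b, 0 ≤ φ' t)
    {s t : ℝ} (hs : s ∈ Icc a b) (ht : t ∈ Icc a b) (hst : s ≤ t) : φ s ≤ φ t := by
  refine monotoneOn_of_hasDerivWithinAt_nonneg (convex_Icc a b)
    (fun t ht => (hd t ht).continuousWithinAt)
    (fun t ht => (hd t (interior_subset ht)).mono interior_subset)
    (fun t ht => h t (interior_subset ht)) hs ht hst

variable {X : Type*} [TopologicalSpace X]

/-- The properties of the logarithm `L` of the conformal factor and of the scalar curvature `S`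
along the flow `∂ₜL = k (f(S) - A)` on `[0, b]` that enter the maximum principle. -/
structure IsFlow (f : ℝ → ℝ) (k κ b : ℝ) (L S : ℝ → X → ℝ) (A : ℝ → ℝ) : Prop where
  continuousOn_log : ContinuousOn (fun z : ℝ × X => L z.1 z.2) (Icc 0 b ×ˢ univ)
  continuousOn_scalar : ContinuousOn (fun z : ℝ × X => S z.1 z.2) (Icc 0 b ×ˢ univ)
  hasDeriv : ∀ t ∈ Icc 0 b, ∀ p,
    HasDerivWithinAt (fun s => L s p) (k * (f (S t p) - A t)) (Icc 0 b) t
  average_le : ∀ t ∈ Icc 0 b, ∀ C, (∀ p, f (S t p) ≤ C) → A t ≤ C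
  compare : ∀ s ∈ Icc 0 b, ∀ t ∈ Icc 0 b, ∀ p, (∀ q, L t q - L s q ≤ L t p - L s p) →
    Real.exp (-(κ * (L t p - L s p))) * S s p ≤ S t p
  nonneg_of_max : ∀ t ∈ Icc 0 b, ∀ p, (∀ q, L t q ≤ L t p) → 0 ≤ S t p
  nonpos_of_min : ∀ t ∈ Icc 0 b, ∀ p, (∀ q, L t p ≤ L t q) → S t p ≤ 0

namespace IsFlow

variable {f : ℝ → ℝ} {k κ b : ℝ} {L S : ℝ → X → ℝ} {A : ℝ → ℝ}

/-- A primitive `B` of `-k A`, by which `L - B` becomes the logarithm of the conformal factor of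
the unnormalized flow. It exists without any regularity of `A`, because
`k A = k f(S(·, p₀)) - ∂ₜL(·, p₀)`. -/
theorem exists_primitive (h : IsFlow f k κ b L S A) (hf : Continuous f) (hb : 0 ≤ b) [Nonempty X] :
    ∃ B : ℝ → ℝ, ∀ t ∈ Icc 0 b, HasDerivWithinAt B (-(k * A t)) (Icc 0 b) t := by
  obtain ⟨p₀⟩ := ‹Nonempty X›
  have hc : ContinuousOn (fun t => f (S t p₀)) (Icc 0 b) :=
    hf.comp_continuousOn (h.continuousOn_scalar.comp (by fun_prop : ContinuousOn
      (fun t : ℝ => (t, p₀)) (Icc 0 b)) fun t ht => ⟨ht, mem_univ _⟩)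
  have hc' : Continuous (IccExtend hb ((Icc 0 b).domRestrict fun t => f (S t p₀))) :=
    hc.domRestrict.Icc_extend'
  refine ⟨fun t => L t p₀ - k * ∫ τ in (0 : ℝ)..t,
    IccExtend hb ((Icc 0 b).domRestrict fun t => f (S t p₀)) τ, fun t ht => ?_⟩
  have h1 := ((hc'.integral_hasStrictDerivAt 0 t).hasDerivAt.hasDerivWithinAt
    (s := Icc 0 b)).const_mul k
  rw [IccExtend_of_mem _ _ ht] at h1
  refine ((h.hasDeriv t ht p₀).sub h1).congr_deriv ?_
  simp only [domRestrict_apply]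
  ring

theorem continuous_log (h : IsFlow f k κ b L S A) {t : ℝ} (ht : t ∈ Icc 0 b) :
    Continuous (L t) :=
  continuousOn_univ.1 (h.continuousOn_log.comp (f := fun p => (t, p)) (by fun_prop)
    fun p _ => ⟨ht, mem_univ p⟩)

theorem continuous_scalar (h : IsFlow f k κ b L S A) {t : ℝ} (ht : t ∈ Icc 0 b) :
    Continuous (S t) :=
  continuousOn_univ.1 (h.continuousOn_scalar.comp (f := fun p => (t, p)) (by fun_prop)
    fun p _ => ⟨ht, mem_univ p⟩)

end IsFlow

variable [CompactSpace X]

/-- The parabolic maximum principle: if `W` has non-positive time derivative at its spatial maxima,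
then an upper bound for `W` at the initial time is preserved. -/
theorem le_of_deriv_nonpos_at_max {b : ℝ} {W W' : ℝ → X → ℝ}
    (hW : ContinuousOn (fun z : ℝ × X => W z.1 z.2) (Icc 0 b ×ˢ univ))
    (hd : ∀ t ∈ Icc 0 b, ∀ p, HasDerivWithinAt (fun s => W s p) (W' t p) (Icc 0 b) t)
    (hmax : ∀ t ∈ Icc 0 b, ∀ p, (∀ q, W t q ≤ W t p) → W' t p ≤ 0)
    {C : ℝ} (hC : ∀ p, W 0 p ≤ C) {t : ℝ} (ht : t ∈ Icc 0 b) (p : X) : W t p ≤ C := by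
  have hb : 0 ≤ b := ht.1.trans ht.2
  -- the perturbation `- ε t` makes the maximum principle strict
  have key : ∀ ε > 0, W t p ≤ C + ε * t := by
    intro ε hε
    have hc : ContinuousOn (fun z : ℝ × X => W z.1 z.2 - ε * z.1) (Icc 0 b ×ˢ univ) :=
      hW.sub (by fun_prop)
    obtain ⟨⟨t', p'⟩, hm, hm'⟩ := (isCompact_Icc.prod isCompact_univ).exists_isMaxOn
      ⟨(t, p), ht, mem_univ p⟩ hc
    have hm'' : ∀ τ ∈ Icc 0 b, ∀ q, W τ q - ε * τ ≤ W t' p' - ε * t' := fun τ hτ q =>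
      hm' (show (τ, q) ∈ Icc 0 b ×ˢ univ from ⟨hτ, mem_univ q⟩)
    have ht' : t' ∈ Icc 0 b := hm.1
    rcases ht'.1.eq_or_lt with h0 | h0
    · have h1 := hm'' t ht p
      have h2 := hC p'
      rw [← h0] at h1
      linarith
    · have h1 := hmax t' ht' p' fun q => by linarith [hm'' t' ht' q]
      have h2 := (hd t' ht' p').sub ((hasDerivWithinAt_id t' (Icc 0 b)).const_mul ε)
      have h3 := deriv_nonneg_of_forall_le_right le_rfl h0 ht'.2 h2 fun τ hτ =>
        hm'' τ ⟨hτ.1, hτ.2.le.trans ht'.2⟩ p'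
      linarith
  refine le_of_forall_pos_le_add fun ε hε => ?_
  have h1 := key (ε / (t + 1)) (div_pos hε (by linarith [ht.1]))
  have h2 : ε / (t + 1) * t ≤ ε := by
    rw [div_mul_eq_mul_div, div_le_iff₀ (by linarith [ht.1])]
    nlinarith [ht.1]
  linarith

namespace IsFlow

variable {f : ℝ → ℝ} {k κ b : ℝ} {L S : ℝ → X → ℝ} {A : ℝ → ℝ}

/-- The oscillation of the logarithm of the conformal factor does not increase: the unnormalized
flow decreases the maximum and increases the minimum of `L - k f(0) t`. -/
theorem sub_le_of_initial (h : IsFlow f k κ b L S A) (hf : Continuous f) (hanti : StrictAnti f)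
    (hk : 0 < k) {m₀ M₀ : ℝ} (hm₀ : ∀ p, m₀ ≤ L 0 p) (hM₀ : ∀ p, L 0 p ≤ M₀) {t : ℝ}
    (ht : t ∈ Icc 0 b) (p q : X) : L t p - L t q ≤ M₀ - m₀ := by
  have : Nonempty X := ⟨p⟩
  obtain ⟨B, hB⟩ := h.exists_primitive hf (ht.1.trans ht.2)
  have hBc : ContinuousOn (fun z : ℝ × X => B z.1) (Icc 0 b ×ˢ univ) :=
    ContinuousOn.comp (g := B) (fun t ht => (hB t ht).continuousWithinAt) continuousOn_fst
      fun z hz => hz.1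
  have hWc : ContinuousOn (fun z : ℝ × X => L z.1 z.2 - B z.1 - k * f 0 * z.1)
      (Icc 0 b ×ˢ univ) := (h.continuousOn_log.sub hBc).sub (by fun_prop)
  have hWd : ∀ t ∈ Icc 0 b, ∀ p, HasDerivWithinAt (fun s => L s p - B s - k * f 0 * s)
      (k * (f (S t p) - f 0)) (Icc 0 b) t := fun t ht p =>
    (((h.hasDeriv t ht p).sub (hB t ht)).sub ((hasDerivWithinAt_id t (Icc 0 b)).const_mul
      (k * f 0))).congr_deriv (by ring)
  have h1 : L t p - B t - k * f 0 * t ≤ M₀ - B 0 := by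
    refine le_of_deriv_nonpos_at_max (W := fun s p => L s p - B s - k * f 0 * s) hWc hWd
      (fun τ hτ x hx => ?_) (fun x => by simpa using hM₀ x) ht p
    have := hanti.antitone (h.nonneg_of_max τ hτ x fun y => by linarith [hx y])
    exact mul_nonpos_of_nonneg_of_nonpos hk.le (by linarith)
  have h2 : -(L t q - B t - k * f 0 * t) ≤ -(m₀ - B 0) := by
    refine le_of_deriv_nonpos_at_max (W := fun s p => -(L s p - B s - k * f 0 * s)) hWc.neg
      (fun τ hτ x => (hWd τ hτ x).neg) (fun τ hτ x hx => ?_) (fun x => by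
        have := hm₀ x
        simp only [mul_zero]
        linarith) ht q
    have := hanti.antitone (h.nonpos_of_min τ hτ x fun y => by linarith [hx y])
    have := mul_nonneg hk.le (sub_nonneg.2 this)
    linarith
  linarith

end IsFlow
end ParabolicMaximumPrinciple

/-! ### The lower bound for the scalar curvature -/

section ScalarCurvatureBound

open Set

variable {X : Type*} [TopologicalSpace X] [CompactSpace X]
  {f : ℝ → ℝ} {k κ b : ℝ} {L S : ℝ → X → ℝ} {A : ℝ → ℝ}

theorem exists_lipschitz_const_of_contDiff (hf : ContDiff ℝ 1 f) (R : ℝ) :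
    ∃ C, 0 ≤ C ∧ ∀ x ∈ Icc (-R) R, ∀ y ∈ Icc (-R) R, |f x - f y| ≤ C * |x - y| := by
  obtain ⟨C, hC⟩ := (isCompact_Icc (a := -R) (b := R)).exists_bound_of_continuousOn
    (hf.continuous_deriv le_rfl).continuousOn
  refine ⟨max C 0, le_max_right _ _, fun x hx y hy => ?_⟩
  exact (convex_Icc (-R) R).norm_image_sub_le_of_norm_deriv_le
    (fun z _ => hf.differentiable (by norm_num) z) (fun z hz => (hC z hz).trans (le_max_left _ _))
    hy hx

/-- A nonpositive number loses at most a multiple of `γ r` when multiplied by `exp (κ γ r)`. -/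
theorem exp_mul_ge {R κ b γ r d x : ℝ} (hκ : 0 ≤ κ) (hγ0 : 0 ≤ γ) (hγ1 : γ ≤ 1)
    (hr0 : 0 ≤ r) (hrb : r ≤ b) (hd : -(γ * r) ≤ d) (hx0 : x ≤ 0) (hxR : -R ≤ x) :
    x - R * κ * Real.exp (κ * b) * γ * r ≤ Real.exp (-(κ * d)) * x := by
  have h1 : -(κ * d) ≤ κ * (γ * r) := by nlinarith
  have h2 : Real.exp (-(κ * d)) ≤ Real.exp (κ * (γ * r)) := Real.exp_le_exp.2 h1
  set y := κ * (γ * r) with hy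
  have hy0 : 0 ≤ y := by positivity
  have hyb : y ≤ κ * b := mul_le_mul_of_nonneg_left (by nlinarith) hκ
  have h3 : Real.exp y - 1 ≤ y * Real.exp y := by
    have h4 := Real.add_one_le_exp (-y)
    have h5 : Real.exp (-y) * Real.exp y = 1 := by rw [← Real.exp_add]; simp
    nlinarith [Real.exp_pos y]
  have h4 : y * Real.exp y ≤ y * Real.exp (κ * b) :=
    mul_le_mul_of_nonneg_left (Real.exp_le_exp.2 hyb) hy0
  have h5 : Real.exp y * x ≤ Real.exp (-(κ * d)) * x := mul_le_mul_of_nonpos_right h2 hx0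
  have hR : 0 ≤ R := by linarith
  have h6 : (Real.exp y - 1) * (-x) ≤ y * Real.exp (κ * b) * R :=
    mul_le_mul (h3.trans h4) (by linarith) (by linarith) (by positivity)
  have h7 : y * Real.exp (κ * b) * R = R * κ * Real.exp (κ * b) * γ * r := by rw [hy]; ring
  linarith

/-- The lower bound for the scalar curvature is preserved. Since `S` need not be differentiable,
the maximum principle is applied to the two-time function `v(t, p) - v(s, p)`, `s ≤ t`, where
`v = L - B - Λ`: here `L - B` is the logarithm of the conformal factor of the unnormalized flow,
with time derivative `k f(S)`, and `Λ' = λ` is an increasing affine function such that the maximum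
of `k f(S) - λ` over space and time is a small number `γ > 0`. -/
theorem IsFlow.le_scalar (h : IsFlow f k κ b L S A) (hf : ContDiff ℝ 1 f) (hanti : StrictAnti f)
    (hk : 0 < k) (hκ : 0 ≤ κ) {σ : ℝ} (hσ0 : σ ≤ 0) (hσ : ∀ p, σ ≤ S 0 p) {t : ℝ}
    (ht : t ∈ Icc 0 b) (p : X) : σ ≤ S t p := by
  by_contra! hlt
  have hb : 0 ≤ b := ht.1.trans ht.2
  have : Nonempty X := ⟨p⟩
  obtain ⟨B, hB⟩ := h.exists_primitive hf.continuous hb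
  have hf_lt : k * f σ < k * f (S t p) := mul_lt_mul_of_pos_left (hanti hlt) hk
  -- the slope `η` of `λ`
  set η := (k * f (S t p) - k * f σ) / (2 * (b + 1)) with hη_def
  have hη : 0 < η := div_pos (by linarith) (by linarith)
  have hηb : k * f σ < k * f (S t p) - η * b := by
    have : η * (2 * (b + 1)) = k * f (S t p) - k * f σ := div_mul_cancel₀ _ (by positivity)
    nlinarith
  -- the maximum `Ψ` of `k f(S) - η t`
  have hfS : ContinuousOn (fun z : ℝ × X => k * f (S z.1 z.2) - η * z.1) (Icc 0 b ×ˢ univ) :=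
    ((hf.continuous.comp_continuousOn h.continuousOn_scalar).const_mul k).sub (by fun_prop)
  obtain ⟨⟨t₁, p₁⟩, hm₁, hmax₁⟩ := (isCompact_Icc.prod isCompact_univ).exists_isMaxOn
    ⟨(t, p), ht, mem_univ p⟩ hfS
  have ht₁ : t₁ ∈ Icc 0 b := hm₁.1
  set Ψ := k * f (S t₁ p₁) - η * t₁ with hΨ
  have hΨ_max : ∀ τ ∈ Icc 0 b, ∀ q, k * f (S τ q) - η * τ ≤ Ψ := fun τ hτ q =>
    hmax₁ (show (τ, q) ∈ Icc 0 b ×ˢ univ from ⟨hτ, mem_univ q⟩)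
  have hΨσ : k * f σ < Ψ := by
    have := hΨ_max t ht p
    nlinarith [ht.2]
  -- a bound for `S`, a Lipschitz constant for `f`, and the gap `γ`
  obtain ⟨R, hR⟩ := (isCompact_Icc.prod isCompact_univ).exists_bound_of_continuousOn
    h.continuousOn_scalar
  have hR' : ∀ τ ∈ Icc 0 b, ∀ q, S τ q ∈ Icc (-R) R := fun τ hτ q =>
    abs_le.1 (hR (τ, q) ⟨hτ, mem_univ q⟩)
  have hR0 : 0 ≤ R := (norm_nonneg _).trans (hR (t, p) ⟨ht, mem_univ p⟩)
  obtain ⟨C, hC0, hC⟩ := exists_lipschitz_const_of_contDiff hf R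
  set C₁ := R * κ * Real.exp (κ * b) with hC₁
  have hC₁0 : 0 ≤ C₁ := by positivity
  set γ := min 1 (min ((Ψ - k * f σ) / 2) (η / (2 * (k * C * C₁ + 1)))) with hγ_def
  have hD : 0 ≤ k * C * C₁ := by positivity
  have hγ : 0 < γ := lt_min one_pos (lt_min (by linarith) (by positivity))
  have hγ1 : γ ≤ 1 := min_le_left _ _
  have hγ2 : γ ≤ (Ψ - k * f σ) / 2 := (min_le_right _ _).trans (min_le_left _ _)
  have hγ3 : k * C * C₁ * γ < η := by
    have h1 : γ ≤ η / (2 * (k * C * C₁ + 1)) := (min_le_right _ _).trans (min_le_right _ _)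
    rw [le_div_iff₀ (by positivity)] at h1
    nlinarith
  set l := Ψ - γ with hl
  have hlσ : k * f σ < l := by linarith
  set Λ : ℝ → ℝ := fun τ => l * τ + η * τ ^ 2 / 2 with hΛ
  have hΛd (τ : ℝ) : HasDerivWithinAt Λ (l + η * τ) (Icc 0 b) τ := by
    have h1 := ((hasDerivAt_id τ).const_mul l).add
      ((((hasDerivAt_id τ).pow 2).const_mul η).div_const 2)
    exact (h1.congr_deriv (by simp; ring)).hasDerivWithinAt
  set v : ℝ → X → ℝ := fun τ q => L τ q - B τ - Λ τ with hv
  have hvd : ∀ τ ∈ Icc 0 b, ∀ q, HasDerivWithinAt (fun s => v s q)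
      (k * f (S τ q) - (l + η * τ)) (Icc 0 b) τ := fun τ hτ q =>
    (((h.hasDeriv τ hτ q).sub (hB τ hτ)).sub (hΛd τ)).congr_deriv (by ring)
  have hBc : ContinuousOn B (Icc 0 b) := fun τ hτ => (hB τ hτ).continuousWithinAt
  have hvc : ContinuousOn (fun z : ℝ × X => v z.1 z.2) (Icc 0 b ×ˢ univ) :=
    (h.continuousOn_log.sub (hBc.comp continuousOn_fst fun z hz => hz.1)).sub
      (by simp only [hΛ]; fun_prop)
  -- the maximum of the two-time function
  set K : Set ((ℝ × ℝ) × X) := ((Icc 0 b ×ˢ Icc 0 b) ×ˢ univ) ∩ {z | z.1.1 ≤ z.1.2}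
  have hKc : IsCompact K := ((isCompact_Icc.prod isCompact_Icc).prod isCompact_univ).inter_right
    (isClosed_le (by fun_prop) (by fun_prop))
  have hHc : ContinuousOn (fun z : (ℝ × ℝ) × X => v z.1.2 z.2 - v z.1.1 z.2) K :=
    (hvc.comp (f := fun z : (ℝ × ℝ) × X => (z.1.2, z.2)) (by fun_prop)
        fun z hz => ⟨hz.1.1.2, mem_univ _⟩).sub
      (hvc.comp (f := fun z : (ℝ × ℝ) × X => (z.1.1, z.2)) (by fun_prop)
        fun z hz => ⟨hz.1.1.1, mem_univ _⟩)
  have h0b : (0 : ℝ) ∈ Icc 0 b := ⟨le_rfl, hb⟩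
  obtain ⟨⟨⟨s, r⟩, q⟩, hmem, hmax⟩ := hKc.exists_isMaxOn
    ⟨((0, 0), p), ⟨⟨h0b, h0b⟩, mem_univ p⟩, le_refl (0 : ℝ)⟩ hHc
  have hs : s ∈ Icc 0 b := hmem.1.1.1
  have hr : r ∈ Icc 0 b := hmem.1.1.2
  have hsr : s ≤ r := hmem.2
  have hM : ∀ s' ∈ Icc 0 b, ∀ r' ∈ Icc 0 b, s' ≤ r' → ∀ q', v r' q' - v s' q' ≤ v r q - v s q :=
    fun s' hs' r' hr' hsr' q' => hmax (show ((s', r'), q') ∈ K from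
      ⟨⟨⟨hs', hr'⟩, mem_univ _⟩, hsr'⟩)
  -- it is positive, as seen from the derivative `γ` of `v` at `(t₁, p₁)`
  have hpos : 0 < v r q - v s q := by
    by_contra! hle
    have ht₁0 : 0 < t₁ := by
      refine ht₁.1.lt_of_ne fun h0 => ?_
      have h1 := mul_le_mul_of_nonneg_left (hanti.antitone (hσ p₁)) hk.le
      rw [hΨ, ← h0] at hΨσ
      linarith
    have h1 := deriv_nonpos_of_forall_ge_right le_rfl ht₁0 ht₁.2 (hvd t₁ ht₁ p₁) fun τ hτ => by
      have := hM τ ⟨hτ.1, hτ.2.le.trans ht₁.2⟩ t₁ ht₁ hτ.2.le p₁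
      linarith
    linarith
  have hsr' : s < r := hsr.lt_of_ne fun h0 => by simp [h0] at hpos
  have hSr : l + η * r ≤ k * f (S r q) := by
    have := deriv_nonneg_of_forall_le_right hs.1 hsr' hr.2 (hvd r hr q) fun τ hτ => by
      have := hM s hs τ ⟨hs.1.trans hτ.1, hτ.2.le.trans hr.2⟩ hτ.1 q
      linarith
    linarith
  have hSs : l + η * s ≤ k * f (S s q) := by
    have := deriv_nonneg_of_forall_ge_left hs.1 hsr' hr.2 (hvd s hs q) fun τ hτ => by
      have := hM τ ⟨hs.1.trans hτ.1.le, hτ.2.trans hr.2⟩ r hr hτ.2 q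
      linarith
    linarith
  have hs0 : 0 < s := by
    refine hs.1.lt_of_ne fun h0 => ?_
    rw [← h0] at hSs
    have h1 := mul_le_mul_of_nonneg_left (hanti.antitone (hσ q)) hk.le
    linarith
  have hSs' : k * f (S s q) ≤ l + η * s := by
    have := deriv_nonpos_of_forall_ge_right le_rfl hs0 hs.2 (hvd s hs q) fun τ hτ => by
      have := hM τ ⟨hτ.1, hτ.2.le.trans hs.2⟩ r hr (hτ.2.le.trans hsr) q
      linarith
    linarith
  have hSσ : S s q ≤ 0 := by
    refine (hanti.lt_iff_gt.1 (lt_of_mul_lt_mul_left (a := k) ?_ hk.le)).le.trans hσ0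
    nlinarith
  -- the conformal factor almost increases, since `k A ≤ k max f(S) ≤ λ + γ`
  have hd : -(γ * (r - s)) ≤ L r q - L s q := by
    have hA : ∀ τ ∈ Icc 0 b, k * A τ ≤ Ψ + η * τ := fun τ hτ => by
      have h1 := h.average_le τ hτ ((Ψ + η * τ) / k) fun x => by
        rw [le_div_iff₀' hk]
        linarith [hΨ_max τ hτ x]
      rwa [le_div_iff₀' hk] at h1
    have h1 := sub_nonneg_of_deriv_nonneg (φ := fun τ => Λ τ + B τ + γ * τ)
      (fun τ hτ => ((hΛd τ).add (hB τ hτ)).add ((hasDerivWithinAt_id τ _).const_mul γ))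
      (fun τ hτ => by linarith [hA τ hτ]) hs hr hsr
    simp only [hv] at hpos h1
    linarith
  have hcmp := h.compare s hs r hr q fun x => by
    have := hM s hs r hr hsr x
    simp only [hv] at this
    linarith
  have hge : S s q - C₁ * γ * (r - s) ≤ S r q :=
    (exp_mul_ge hκ hγ.le hγ1 (sub_nonneg.2 hsr) (by linarith [hr.2, hs.1]) hd hSσ
      (hR' s hs q).1).trans hcmp
  have hfle : f (S r q) - f (S s q) ≤ C * (C₁ * γ * (r - s)) := by
    have h0 : 0 ≤ C₁ * γ * (r - s) := mul_nonneg (by positivity) (sub_nonneg.2 hsr)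
    rcases le_total (S s q) (S r q) with h1 | h1
    · have := hanti.antitone h1
      have := mul_nonneg hC0 h0
      linarith
    · refine (le_abs_self _).trans ((hC _ (hR' r hr q) _ (hR' s hs q)).trans ?_)
      refine mul_le_mul_of_nonneg_left ?_ hC0
      rw [abs_sub_comm, abs_of_nonneg (sub_nonneg.2 h1)]
      linarith
  have hfin : η * (r - s) ≤ k * C * C₁ * γ * (r - s) := by
    have := mul_le_mul_of_nonneg_left hfle hk.le
    nlinarith
  exact absurd (le_of_mul_le_mul_right hfin (sub_pos.2 hsr')) (not_le.2 hγ3)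

end ScalarCurvatureBound

/-! ### Conservation of volume and bounds for the conformal factor -/

section VolumePreservation

open Set

variable {X : Type*} [TopologicalSpace X] [CompactSpace X] [MeasurableSpace X] [BorelSpace X]
  {f : ℝ → ℝ} {k κ b : ℝ} {L S : ℝ → X → ℝ} {A : ℝ → ℝ}

theorem integrable_of_continuous {μ : Measure X} [IsFiniteMeasure μ] {φ : X → ℝ}
    (hφ : Continuous φ) : Integrable φ μ := by
  rw [← integrableOn_univ]
  exact hφ.continuousOn.integrableOn_compact' isCompact_univ MeasurableSet.univ

namespace IsFlow

/-- If `A` is the mean value of `f(S)` with respect to `exp(q L) μ`, then the total mass of this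
measure is constant. -/
theorem integral_exp_eq (h : IsFlow f k κ b L S A) (hf : Continuous f) (μ : Measure X)
    [IsFiniteMeasure μ] [NeZero μ] (q : ℝ) (hA : ∀ t ∈ Icc 0 b,
      ∫ p, Real.exp (q * L t p) * f (S t p) ∂μ = A t * ∫ p, Real.exp (q * L t p) ∂μ)
    (hb : 0 ≤ b) : ∫ p, Real.exp (q * L b p) ∂μ = ∫ p, Real.exp (q * L 0 p) ∂μ := by
  have hcE : ∀ t ∈ Icc 0 b, Continuous fun p => Real.exp (q * L t p) := fun t ht =>
    ((h.continuous_log ht).const_mul q).rexp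
  have hcS : ∀ t ∈ Icc 0 b, Continuous fun p => f (S t p) := fun t ht =>
    hf.comp (h.continuous_scalar ht)
  obtain ⟨E, hE⟩ := (isCompact_Icc.prod isCompact_univ).exists_bound_of_continuousOn
    (h.continuousOn_log.const_mul q).rexp
  obtain ⟨R, hR⟩ := (isCompact_Icc.prod isCompact_univ).exists_bound_of_continuousOn
    (hf.comp_continuousOn h.continuousOn_scalar)
  have hE' : ∀ t ∈ Icc 0 b, ∀ p, Real.exp (q * L t p) ≤ E := fun t ht p =>
    (le_abs_self _).trans (hE (t, p) ⟨ht, mem_univ p⟩)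
  have hR' : ∀ t ∈ Icc 0 b, ∀ p, |f (S t p)| ≤ R := fun t ht p => hR (t, p) ⟨ht, mem_univ p⟩
  have hAR : ∀ t ∈ Icc 0 b, |A t| ≤ R := by
    intro t ht
    have hi := integrable_of_continuous (μ := μ) (hcE t ht)
    have hpos : 0 < ∫ p, Real.exp (q * L t p) ∂μ := integral_exp_pos hi
    have h1 : |∫ p, Real.exp (q * L t p) * f (S t p) ∂μ| ≤ ∫ p, R * Real.exp (q * L t p) ∂μ := by
      rw [← Real.norm_eq_abs]
      refine norm_integral_le_of_norm_le (hi.const_mul R) (Eventually.of_forall fun p => ?_)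
      rw [Real.norm_eq_abs, abs_mul, abs_of_pos (Real.exp_pos _), mul_comm]
      exact mul_le_mul_of_nonneg_right (hR' t ht p) (Real.exp_pos _).le
    rw [hA t ht, abs_mul, abs_of_pos hpos, integral_const_mul] at h1
    exact le_of_mul_le_mul_right h1 hpos
  have hcont : ContinuousOn (fun t => ∫ p, Real.exp (q * L t p) ∂μ) (Icc 0 b) := by
    refine continuousOn_of_dominated (bound := fun _ => E)
      (fun t ht => (hcE t ht).aestronglyMeasurable) (fun t ht => Eventually.of_forall fun p => ?_)
      (integrable_const _) (Eventually.of_forall fun p => ?_)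
    · exact hE (t, p) ⟨ht, mem_univ p⟩
    · exact (h.continuousOn_log.const_mul q).rexp.comp (f := fun t : ℝ => (t, p)) (by fun_prop)
        fun t ht => ⟨ht, mem_univ p⟩
  have hderiv : ∀ t ∈ Ioo 0 b, HasDerivAt (fun t => ∫ p, Real.exp (q * L t p) ∂μ) 0 t := by
    intro t ht
    have hd : ∀ τ ∈ Ioo 0 b, ∀ p, HasDerivAt (fun s => Real.exp (q * L s p))
        (Real.exp (q * L τ p) * (q * (k * (f (S τ p) - A τ)))) τ := fun τ hτ p =>
      (((h.hasDeriv τ (Ioo_subset_Icc_self hτ) p).hasDerivAt (Icc_mem_nhds hτ.1 hτ.2)).const_mul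
        q).exp
    have ht' := Ioo_subset_Icc_self ht
    have h1 := hasDerivAt_integral_of_dominated_loc_of_deriv_le (μ := μ) (𝕜 := ℝ)
      (F := fun t p => Real.exp (q * L t p))
      (F' := fun t p => Real.exp (q * L t p) * (q * (k * (f (S t p) - A t))))
      (bound := fun _ => E * (|q| * (|k| * (R + R)))) (s := Ioo 0 b) (x₀ := t)
      (Ioo_mem_nhds ht.1 ht.2)
      (by filter_upwards [Ioo_mem_nhds ht.1 ht.2] with τ hτ using
        (hcE τ (Ioo_subset_Icc_self hτ)).aestronglyMeasurable)
      (integrable_of_continuous (hcE t ht'))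
      ((hcE t ht').mul (continuous_const.mul (continuous_const.mul
        ((hcS t ht').sub continuous_const)))).aestronglyMeasurable
      (Eventually.of_forall fun p τ hτ => by
        have hτ' := Ioo_subset_Icc_self hτ
        rw [norm_mul, norm_mul, norm_mul]
        simp only [Real.norm_eq_abs]
        have h0 : |Real.exp (q * L τ p)| ≤ E := hE (τ, p) ⟨hτ', mem_univ p⟩
        have h1 : |f (S τ p) - A τ| ≤ R + R :=
          (abs_sub _ _).trans (add_le_add (hR' τ hτ' p) (hAR τ hτ'))
        gcongr
        exact (abs_nonneg _).trans h0)
      (integrable_const _) (Eventually.of_forall fun p τ hτ => hd τ hτ p)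
    refine h1.2.congr_deriv ?_
    have e : ∀ p, Real.exp (q * L t p) * (q * (k * (f (S t p) - A t)))
        = q * k * (Real.exp (q * L t p) * f (S t p) - A t * Real.exp (q * L t p)) :=
      fun p => by ring
    simp only [e]
    rw [integral_const_mul, integral_sub, integral_const_mul, hA t ht', sub_self, mul_zero]
    · exact integrable_of_continuous ((hcE t ht').mul (hcS t ht'))
    · exact (integrable_of_continuous (hcE t ht')).const_mul _
  rcases hb.eq_or_lt with rfl | hb
  · rfl
  obtain ⟨τ, hτ, h1⟩ := exists_hasDerivAt_eq_slope _ _ hb hcont hderiv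
  rw [eq_comm, div_eq_zero_iff] at h1
  rcases h1 with h1 | h1 <;> linarith

/-- A bound for `L` in terms of its initial values: the oscillation of `L` does not increase, and
since the mass of `exp(q L) μ` is preserved, `L(b)` can be neither everywhere above nor everywhere
below `L(0)`. -/
theorem abs_log_le (h : IsFlow f k κ b L S A) (hf : Continuous f) (hanti : StrictAnti f)
    (hk : 0 < k) (μ : Measure X) [IsFiniteMeasure μ] [NeZero μ] {q : ℝ} (hq : 0 < q)
    (hA : ∀ t ∈ Icc 0 b,
      ∫ p, Real.exp (q * L t p) * f (S t p) ∂μ = A t * ∫ p, Real.exp (q * L t p) ∂μ)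
    (hb : 0 ≤ b) {R : ℝ} (hR : ∀ p, |L 0 p| ≤ R) (p : X) : |L b p| ≤ 3 * R := by
  have h0 : (0 : ℝ) ∈ Icc 0 b := ⟨le_rfl, hb⟩
  have hb' : b ∈ Icc 0 b := ⟨hb, le_rfl⟩
  have hV := h.integral_exp_eq hf μ q hA hb
  have hosc := h.sub_le_of_initial hf hanti hk (fun p => (abs_le.1 (hR p)).1)
    (fun p => (abs_le.1 (hR p)).2) hb'
  have hi (t) (ht : t ∈ Icc 0 b) : Integrable (fun p => Real.exp (q * L t p)) μ :=
    integrable_of_continuous ((h.continuous_log ht).const_mul q).rexp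
  have key {s t : ℝ} (hs : s ∈ Icc 0 b) (ht : t ∈ Icc 0 b)
      (heq : ∫ p, Real.exp (q * L s p) ∂μ = ∫ p, Real.exp (q * L t p) ∂μ) :
      ∃ x, L s x ≤ L t x := by
    obtain ⟨x, hx⟩ := exists_le_average (NeZero.ne μ) ((hi s hs).sub (hi t ht))
    refine ⟨x, ?_⟩
    rw [average_eq] at hx
    simp only [Pi.sub_apply] at hx
    rw [integral_sub (hi s hs) (hi t ht), heq, sub_self, smul_zero, sub_nonpos,
      Real.exp_le_exp] at hx
    exact le_of_mul_le_mul_left hx hq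
  obtain ⟨x, hx⟩ := key hb' h0 hV
  obtain ⟨y, hy⟩ := key h0 hb' hV.symm
  have hx' := abs_le.1 (hR x)
  have hy' := abs_le.1 (hR y)
  rw [abs_le]
  constructor
  · linarith [hosc y p]
  · linarith [hosc p x]

end IsFlow
end VolumePreservation

/-! ### The generalized Yamabe flow -/

section Flow

open Set

variable {n : ℕ} {M : Type*} [TopologicalSpace M] [ChartedSpace (EuclideanSpace ℝ (Fin n)) M]
  [IsManifold (𝓡 n) ∞ M] [T2Space M] [CompactSpace M] [MeasurableSpace M] [BorelSpace M]
  (g₀ : Bundle.ContMDiffRiemannianMetric (𝓡 n) ∞ (EuclideanSpace ℝ (Fin n))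
    (fun p : M => TangentSpace (𝓡 n) p))

theorem integral_rpow_pos [Nonempty M] {w : M → ℝ} (hw : Continuous w) (hpos : ∀ p, 0 < w p)
    (q : ℝ) : 0 < ∫ p, w p ^ q ∂(riemVolume g₀.inner) := by
  have := isFiniteMeasure_riemVolume g₀
  have : NeZero (riemVolume g₀.inner) := ⟨riemVolume_ne_zero g₀⟩
  simp only [fun p => Real.rpow_def_of_pos (hpos p) q]
  exact integral_exp_pos (integrable_of_continuous
    ((hw.log fun p => (hpos p).ne').mul continuous_const).rexp)

/-- The mean value of `f(S)` for the conformal metric is a quotient of integrals with respect to the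
volume of `g₀`; here the denominator, which is positive, is cleared. -/
theorem averageOfScalar_conformal_mul (hn : 3 ≤ n) [Nonempty M] {w : M → ℝ} (hw : Continuous w)
    (hpos : ∀ p, 0 < w p) (f : ℝ → ℝ) :
    averageOfScalar f (conformal g₀.inner w)
        * ∫ p, w p ^ (2 * (n : ℝ) / ((n : ℝ) - 2)) ∂(riemVolume g₀.inner)
      = ∫ p, w p ^ (2 * (n : ℝ) / ((n : ℝ) - 2)) * f (scalarCurvature (conformal g₀.inner w) p)
        ∂(riemVolume g₀.inner) := by
  have := isFiniteMeasure_riemVolume g₀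
  set q := 2 * (n : ℝ) / ((n : ℝ) - 2)
  have hwq : Continuous fun p => w p ^ q := hw.rpow_const fun p => Or.inl (hpos p).ne'
  have hm : Measurable fun p => ENNReal.ofReal (w p ^ q) := hwq.measurable.ennreal_ofReal
  have hi : Integrable (fun p => w p ^ q) (riemVolume g₀.inner) := integrable_of_continuous hwq
  have hnn (p : M) : 0 ≤ w p ^ q := Real.rpow_nonneg (hpos p).le _
  have hV : (riemVolume (conformal g₀.inner w)).real univ
      = ∫ p, w p ^ q ∂(riemVolume g₀.inner) := by
    rw [riemVolume_conformal g₀ hn hw hpos, Measure.real, withDensity_apply _ MeasurableSet.univ,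
      Measure.restrict_univ, integral_eq_lintegral_of_nonneg_ae (Eventually.of_forall hnn)
        hi.aestronglyMeasurable]
  have hVpos := integral_rpow_pos g₀ hw hpos q
  rw [averageOfScalar, hV, mul_comm, ← mul_assoc, mul_inv_cancel₀ hVpos.ne', one_mul,
    riemVolume_conformal g₀ hn hw hpos, integral_withDensity_eq_integral_toReal_smul hm
      (Eventually.of_forall fun p => ENNReal.ofReal_lt_top)]
  refine integral_congr_ae (Eventually.of_forall fun p => ?_)
  simp only [q] at hnn ⊢
  rw [ENNReal.toReal_ofReal (hnn p), smul_eq_mul]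

theorem Icc_subset_timeInterval {T : EReal} {b : ℝ} (hb : b ∈ timeInterval T) :
    Icc 0 b ⊆ timeInterval T := fun _ ht =>
  ⟨ht.1, (EReal.coe_le_coe_iff.2 ht.2).trans_lt hb.2⟩

/-- On a scalar flat background, a solution of the generalized Yamabe flow has the properties
collected in `IsFlow`. -/
theorem isFlow_of_isGeneralizedYamabeFlow (hn : 3 ≤ n) [Nonempty M]
    (hflat : ∀ p : M, scalarCurvature g₀.inner p = 0) {f : ℝ → ℝ} (hf : Continuous f)
    {u₀ : M → ℝ} {T : EReal} {u : ℝ → M → ℝ}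
    (hu : IsGeneralizedYamabeFlow g₀.inner f u₀ T u) {b : ℝ} (hb : b ∈ timeInterval T) :
    IsFlow f (((n : ℝ) - 2) / 4) (4 / ((n : ℝ) - 2)) b (fun t p => Real.log (u t p))
      (fun t p => scalarCurvature (conformal g₀.inner (u t)) p)
      (fun t => averageOfScalar f (conformal g₀.inner (u t))) := by
  have hsub := Icc_subset_timeInterval hb
  have hn3 : (3 : ℝ) ≤ n := by exact_mod_cast hn
  have hn2 : 0 < (n : ℝ) - 2 := by linarith
  set κ := 4 / ((n : ℝ) - 2) with hκ_def
  have hκ : 0 < κ := by positivity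
  set c := 4 * ((n : ℝ) - 1) / (n - 2) with hc_def
  have hc : 0 < c := div_pos (by linarith) hn2
  have hpos : ∀ t ∈ Icc 0 b, ∀ p, 0 < u t p := fun t ht => hu.pos t (hsub ht)
  have hC2 : ∀ t ∈ Icc 0 b, ContMDiff (𝓡 n) 𝓘(ℝ, ℝ) 2 (u t) := fun t ht =>
    hu.contMDiff t (hsub ht)
  have hS : ∀ t ∈ Icc 0 b, ∀ p, scalarCurvature (conformal g₀.inner (u t)) p
      = -(c * u t p ^ (-κ) * (laplacian g₀.inner (u t) p / u t p)) := fun t ht p => by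
    rw [scalarCurvature_conformal g₀ hn (hC2 t ht) (hpos t ht), hflat]
    ring
  have huc : ContinuousOn (fun z : ℝ × M => u z.1 z.2) (Icc 0 b ×ˢ univ) :=
    hu.continuousOn.mono (prod_mono hsub subset_rfl)
  have hSc : ContinuousOn (fun z : ℝ × M => scalarCurvature (conformal g₀.inner (u z.1)) z.2)
      (Icc 0 b ×ˢ univ) := by
    have h1 := hu.continuousOn_laplacian.mono (prod_mono hsub (subset_refl (univ : Set M)))
    refine ContinuousOn.congr ?_ fun z hz => hS z.1 hz.1 z.2
    exact ((continuousOn_const.mul (huc.rpow_const fun z hz =>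
      Or.inl (hpos z.1 hz.1 z.2).ne')).mul (h1.div huc fun z hz => (hpos z.1 hz.1 z.2).ne')).neg
  refine ⟨huc.log fun z hz => (hpos z.1 hz.1 z.2).ne', hSc, ?_, ?_, ?_, ?_, ?_⟩
  · intro t ht p
    -- evaluate the evolution equation on a non-zero tangent vector
    set v : TangentSpace (𝓡 n) p := (EuclideanSpace.single (⟨0, by omega⟩ : Fin n) (1 : ℝ) :
      EuclideanSpace ℝ (Fin n)) with hv
    have hv0 : v ≠ 0 := by
      intro h0
      have : (EuclideanSpace.single (⟨0, by omega⟩ : Fin n) (1 : ℝ)) = 0 := h0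
      simp at this
    set a := g₀.inner p v v with ha_def
    have ha : 0 < a := g₀.pos p v hv0
    have h1 := (hu.evolution t (hsub ht) p v v).mono hsub
    have hcf : ∀ s, conformal g₀.inner (u s) p v v = u s p ^ κ * a := fun s => rfl
    simp only [hcf] at h1
    have h2 := ((h1.log (mul_pos (Real.rpow_pos_of_pos (hpos t ht p) _) ha).ne').sub_const
      (Real.log a)).div_const κ
    refine HasDerivWithinAt.congr_deriv (h2.congr (fun s hs => ?_) ?_) ?_
    · rw [Real.log_mul (Real.rpow_pos_of_pos (hpos s hs p) _).ne' ha.ne',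
        Real.log_rpow (hpos s hs p)]
      field_simp
      ring
    · rw [Real.log_mul (Real.rpow_pos_of_pos (hpos t ht p) _).ne' ha.ne',
        Real.log_rpow (hpos t ht p)]
      field_simp
      ring
    · have := (Real.rpow_pos_of_pos (hpos t ht p) κ).ne'
      rw [mul_div_assoc, div_self (mul_ne_zero this ha.ne'), mul_one, hκ_def]
      field_simp
  · intro t ht C hC
    have := isFiniteMeasure_riemVolume g₀
    have hut : Continuous (u t) := (hC2 t ht).continuous
    have hSt : Continuous fun p => scalarCurvature (conformal g₀.inner (u t)) p :=
      continuousOn_univ.1 (hSc.comp (f := fun p => (t, p)) (by fun_prop)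
        fun p _ => ⟨ht, mem_univ p⟩)
    have h1 := averageOfScalar_conformal_mul g₀ hn hut (hpos t ht) f
    set q := 2 * (n : ℝ) / ((n : ℝ) - 2)
    have hq : Continuous fun p => u t p ^ q := hut.rpow_const fun p => Or.inl (hpos t ht p).ne'
    have hi : Integrable (fun p => u t p ^ q) (riemVolume g₀.inner) := integrable_of_continuous hq
    have hVpos := integral_rpow_pos g₀ hut (hpos t ht) q
    refine le_of_mul_le_mul_right ?_ hVpos
    rw [h1, ← integral_const_mul]
    refine integral_mono (integrable_of_continuous (hq.mul (hf.comp hSt))) (hi.const_mul C)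
      fun p => ?_
    simp only
    rw [mul_comm]
    exact mul_le_mul_of_nonneg_right (hC p) (Real.rpow_nonneg (hpos t ht p).le _)
  · intro s hs t ht p hmax
    set m := u t p / u s p with hm
    have hus := hpos s hs
    have hut := hpos t ht
    have hm0 : 0 < m := div_pos (hut p) (hus p)
    have hd : Real.log (u t p) - Real.log (u s p) = Real.log m :=
      (Real.log_div (hut p).ne' (hus p).ne').symm
    have hle : ∀ q, u t q - m * u s q ≤ u t p - m * u s p := by
      intro q
      have h1 := hmax q
      rw [hd, ← Real.log_div (hut q).ne' (hus q).ne',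
        Real.log_le_log_iff (div_pos (hut q) (hus q)) hm0, div_le_iff₀ (hus q)] at h1
      have h2 : m * u s p = u t p := div_mul_cancel₀ _ (hus p).ne'
      linarith
    have hΔ := laplacian_le_of_isMax g₀ (hC2 t ht) (hC2 s hs) m p hle
    have hutp : u t p = m * u s p := (div_mul_cancel₀ _ (hus p).ne').symm
    have hexp : Real.exp (-(κ * Real.log m)) = m ^ (-κ) := by
      rw [Real.rpow_def_of_pos hm0]
      congr 1
      ring
    rw [hd, hexp, hS s hs, hS t ht, mul_neg, neg_le_neg_iff]
    have h1 : u t p ^ (-κ) = m ^ (-κ) * u s p ^ (-κ) := by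
      rw [hutp, Real.mul_rpow hm0.le (hus p).le]
    have h2 : laplacian g₀.inner (u t) p / u t p ≤ laplacian g₀.inner (u s) p / u s p := by
      rw [div_le_div_iff₀ (hut p) (hus p), hutp]
      nlinarith [mul_le_mul_of_nonneg_right hΔ (hus p).le]
    have h3 : 0 ≤ c * (m ^ (-κ) * u s p ^ (-κ)) := by
      have := Real.rpow_pos_of_pos hm0 (-κ)
      have := Real.rpow_pos_of_pos (hus p) (-κ)
      positivity
    rw [h1]
    calc _ ≤ c * (m ^ (-κ) * u s p ^ (-κ)) * (laplacian g₀.inner (u s) p / u s p) :=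
          mul_le_mul_of_nonneg_left h2 h3
      _ = _ := by ring
  · intro t ht p hmax
    have hut := hpos t ht
    have hle : ∀ q, u t q - 0 * u t q ≤ u t p - 0 * u t p := fun q => by
      simpa using (Real.log_le_log_iff (hut q) (hut p)).1 (hmax q)
    have hΔ := laplacian_le_of_isMax g₀ (hC2 t ht) (hC2 t ht) 0 p hle
    rw [zero_mul] at hΔ
    rw [hS t ht, neg_nonneg]
    exact mul_nonpos_of_nonneg_of_nonpos
      (mul_nonneg hc.le (Real.rpow_nonneg (hut p).le _))
      (div_nonpos_of_nonpos_of_nonneg hΔ (hut p).le)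
  · intro t ht p hmin
    have hut := hpos t ht
    -- the multiple `m = 2` turns the minimum of `u` into a maximum of `u - m u = -u`
    have hle : ∀ q, u t q - 2 * u t q ≤ u t p - 2 * u t p := fun q => by
      have := (Real.log_le_log_iff (hut p) (hut q)).1 (hmin q)
      linarith
    have hΔ := laplacian_le_of_isMax g₀ (hC2 t ht) (hC2 t ht) 2 p hle
    have hΔ' : 0 ≤ laplacian g₀.inner (u t) p := by linarith
    rw [hS t ht, neg_nonpos]
    exact mul_nonneg (mul_nonneg hc.le (Real.rpow_nonneg (hut p).le _)) (div_nonneg hΔ' (hut p).le)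

end Flow

end YamabeFlow

theorem mainTheorem4 {n : ℕ} (hn : 3 ≤ n) {M : Type*} [TopologicalSpace M]
    [ChartedSpace (EuclideanSpace ℝ (Fin n)) M] [IsManifold (𝓡 n) ∞ M]
    [T2Space M] [CompactSpace M] [MeasurableSpace M] [BorelSpace M]
    (g₀ : Bundle.ContMDiffRiemannianMetric (𝓡 n) ∞ (EuclideanSpace ℝ (Fin n))
      (fun p : M => TangentSpace (𝓡 n) p))
    (hflat : ∀ p : M, YamabeFlow.scalarCurvature (n := n) g₀.inner p = 0)
    (u₀ : M → ℝ) (hu₀ : ContMDiff (𝓡 n) 𝓘(ℝ, ℝ) ∞ u₀) (hu₀pos : ∀ p, 0 < u₀ p) :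
    ∃ c : ℝ, 0 < c ∧
      ∀ f : ℝ → ℝ, ContDiff ℝ 2 f → StrictAnti f →
      ∀ T : EReal, 0 < T →
      ∀ u : ℝ → M → ℝ, YamabeFlow.IsGeneralizedYamabeFlow (n := n) g₀.inner f u₀ T u →
      ∀ t ∈ YamabeFlow.timeInterval T,
        (⨅ p : M, YamabeFlow.scalarCurvature (n := n) (YamabeFlow.conformal g₀.inner u₀) p) ≤
            (⨅ p : M, YamabeFlow.scalarCurvature (n := n)
              (YamabeFlow.conformal g₀.inner (u t)) p) ∧
          (⨅ p : M, YamabeFlow.scalarCurvature (n := n)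
              (YamabeFlow.conformal g₀.inner (u t)) p) ≤ 0 ∧
          ∀ p : M, c⁻¹ ≤ u t p ∧ u t p ≤ c := by
  rcases isEmpty_or_nonempty M with hM | hM
  · exact ⟨1, one_pos, fun f _ _ T _ u _ t _ => by simp⟩
  have hlog : Continuous fun p => Real.log (u₀ p) :=
    hu₀.continuous.log fun p => (hu₀pos p).ne'
  obtain ⟨R, hR⟩ := isCompact_univ.exists_bound_of_continuousOn hlog.continuousOn
  refine ⟨Real.exp (3 * R), Real.exp_pos _, fun f hf hanti T _ u hu t ht => ?_⟩
  have hn3 : (3 : ℝ) ≤ n := by exact_mod_cast hn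
  have hn2 : 0 < (n : ℝ) - 2 := by linarith
  have h := YamabeFlow.isFlow_of_isGeneralizedYamabeFlow g₀ hn hflat hf.continuous hu ht
  have h0 : (0 : ℝ) ∈ Set.Icc 0 t := ⟨le_rfl, ht.1⟩
  have htt : t ∈ Set.Icc 0 t := ⟨ht.1, le_rfl⟩
  have hbdd {s : ℝ} (hs : s ∈ Set.Icc 0 t) : BddBelow (Set.range fun p =>
      YamabeFlow.scalarCurvature (YamabeFlow.conformal g₀.inner (u s)) p) :=
    (isCompact_range (h.continuous_scalar hs)).bddBelow
  -- the scalar curvature is nonpositive at a minimum of the conformal factor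
  have hnonpos {s : ℝ} (hs : s ∈ Set.Icc 0 t) :
      (⨅ p, YamabeFlow.scalarCurvature (YamabeFlow.conformal g₀.inner (u s)) p) ≤ 0 := by
    obtain ⟨p, _, hp⟩ := isCompact_univ.exists_isMinOn Set.univ_nonempty
      (h.continuous_log hs).continuousOn
    exact (ciInf_le (hbdd hs) p).trans (h.nonpos_of_min s hs p fun q => hp (Set.mem_univ q))
  have hinit : u 0 = u₀ := hu.initial
  refine ⟨le_ciInf fun p => ?_, hnonpos htt, fun p => ?_⟩
  · rw [← hinit]
    exact h.le_scalar (hf.of_le (by norm_num)) hanti (by positivity) (by positivity)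
      (hnonpos h0) (fun q => ciInf_le (hbdd h0) q) htt p
  · have := YamabeFlow.isFiniteMeasure_riemVolume g₀
    have : NeZero (YamabeFlow.riemVolume g₀.inner) := ⟨YamabeFlow.riemVolume_ne_zero g₀⟩
    have hpos := fun s (hs : s ∈ Set.Icc 0 t) =>
      hu.pos s (YamabeFlow.Icc_subset_timeInterval ht hs)
    have hlogt := h.abs_log_le hf.continuous hanti (by positivity) (YamabeFlow.riemVolume g₀.inner)
      (q := 2 * (n : ℝ) / ((n : ℝ) - 2)) (by positivity) (fun s hs => by
        have h1 := YamabeFlow.averageOfScalar_conformal_mul g₀ hn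
          (hu.contMDiff s (YamabeFlow.Icc_subset_timeInterval ht hs)).continuous (hpos s hs) f
        have h2 : ∀ p, Real.exp (2 * (n : ℝ) / ((n : ℝ) - 2) * Real.log (u s p))
            = u s p ^ (2 * (n : ℝ) / ((n : ℝ) - 2)) := fun p => by
          rw [Real.rpow_def_of_pos (hpos s hs p), mul_comm]
        simp only [h2]
        exact h1.symm) ht.1 (R := R) (fun q => by
          rw [hinit]
          exact hR q (Set.mem_univ q)) p
    rw [abs_le] at hlogt
    have hup := hpos t htt p
    rw [← Real.exp_neg]
    exact ⟨(Real.le_log_iff_exp_le hup).1 hlogt.1, (Real.log_le_iff_le_exp hup).1 hlogt.2⟩
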